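/- **Setting.** A circuit acts on data qubits and auxiliary qubits by a sequence of operations: preparations of a qubit in $|0\rangle$ or $|+\rangle$, CNOTs, destructive single-qubit $Z$- or $X$-basis measurements, $Z$ corrections controlled by measurement outcomes, and, in idealised circuits, non-destructive multi-qubit Pauli-$Z$ measurements, preparation of the cat state $|{+}{+}{+}{+}\rangle+|{-}{-}{-}{-}\rangle$, and the two-qubit *cat-like map* $|{+}{+}\rangle\langle{+}{+}|+|{-}{-}\rangle\langle{-}{-}|$, i.e. the projector onto the $+1$-eigenspace of $X\otimes X$. A circuit reports some parities of its measurement outcomes and may come with linear constraints on its outcomes; it is *total* if in the fault-free case every outcome of non-zero probability satisfies the constraints. A *fault* is a Pauli (modulo phase) on the qubits at every time between operations. The atomic faults of circuit-level noise are: a Pauli on one wire at one time; any Pauli on the outputs of a non-idealised operation; for a non-idealised Pauli measurement, an anticommuting Pauli directly before and after it (a measurement flip) times any Pauli on its outputs; and for a Pauli measurement idealised as *fault-tolerant*, a measurement flip times a (possibly trivial) Pauli on one output. *Fault-free* operations have no atomic faults other than those on their input and output wires. The *weight* of a fault in the group generated by the atomic faults is the least number of atomic faults whose product it is. A fault is *detectable*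 if it flips the parity of some set of measurements whose outcome parity is predetermined in the fault-free circuit. Circuits $C_1,C_2$ on the same data qubits are *fault-equivalent* if, for every $w$, every undetectable fault $F_1$ on $C_1$ of weight less than $w$ has a fault $F_2$ on $C_2$ with $\mathrm{wt}(F_2)\le \mathrm{wt}(F_1)$ such that $C_1^{F_1}=C_2^{F_2}$, and vice versa; here equality means that, on outcomes satisfying the constraints, both have the same action on the data for every value of the reported bits, up to one common positive scalar. A circuit *fault-tolerantly performs a $ZZZZ$ syndrome measurement* if it is fault-equivalent to a single fault-tolerant (but not fault-free) measurement of $Z\otimes Z\otimes Z\otimes Z$ on four data qubits. **Theorem.** 1. *(Optimised Shor-style measurement.)* Let the *Shor-style circuit* prepare the cat state $|{+}{+}{+}{+}\rangle+|{-}{-}{-}{-}\rangle$ (fault-free) on four auxiliary qubits, apply a CNOT from data qubit $i$ to auxiliary qubit $i$ for $i=1,\dots,4$, measure the four auxiliary qubits in the $Z$ basis and report the parity of the outcomes. Let the *optimised circuit* prepare auxiliary qubits $a_1,a_2$ in $|0\rangle$, apply CNOTs from data qubits $1,2$ to $a_1,a_2$ respectively, apply the (fault-free) cat-like map to $a_1,a_2$,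 apply CNOTs from data qubits $3,4$ to $a_1,a_2$ respectively, measure $a_1,a_2$ in the $Z$ basis and report the parity of the two outcomes. Then the optimised circuit is fault-equivalent to the Shor-style circuit, and it fault-tolerantly performs a $ZZZZ$ syndrome measurement. It uses two auxiliary qubits and two measurements, whereas the Shor-style circuit uses four and four. 2. *(The cat-like map.)* The fault-free cat-like map on two qubits is fault-equivalent to the following total circuit: $Z^{x_1}$ on the first qubit; a measurement of $X\otimes X$ with outcome $x_1$ through a bare auxiliary qubit (prepare $|+\rangle$, CNOT from it to the first and then to the second qubit, measure it in the $X$ basis); a second such measurement with outcome $x_2$; $Z^{x_2}$ on the first qubit; with the constraint $x_1=x_2$. 3. *(Implementable circuit.)* Replace the cat-like map in the optimised circuit by the circuit of 2, using one further auxiliary qubit for both $X\otimes X$ measurements, and with the first correction $Z^{x_1}$ applied to data qubit 1 directly after the measurement of $x_1$ instead of to $a_1$ before it. The resulting circuit is implementable (it consists of preparations, CNOTs, single-qubit measurements and $Z$ corrections, none of them idealised, and every correction depends only on an earlier outcome), uses three auxiliary qubits, is total, and under circuit-level noise fault-tolerantly performs a $ZZZZ$ syndrome measurement. -/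

import Mathlib

open scoped BigOperators Matrix

noncomputable section

namespace FaultEq

/-! ### Paulis and basic amplitudes

Computational basis states of qubits indexed by `W` are functions `W → ZMod 2`. -/

/-- The sign `(-1)^s`. -/
def sgn (s : ZMod 2) : ℂ := if s = 0 then 1 else -1

/-- The amplitude `⟨x|+⟩` (for `s = 0`) or `⟨x|-⟩` (for `s = 1`). These amplitudes are real. -/
def ketX (s x : ZMod 2) : ℂ := sgn (s * x) / (Real.sqrt 2 : ℂ)

/-- The phase-free X-spider `|+⟩^{⊗n} ⟨+|^{⊗m} + |-⟩^{⊗n} ⟨-|^{⊗m}` with `m` inputs and `n` outputs: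
its matrix entry at input basis state `a` and output basis state `b`. -/
def xSpider {m n : ℕ} (a : Fin m → ZMod 2) (b : Fin n → ZMod 2) : ℂ :=
  ∑ s : ZMod 2, (∏ i, ketX s (b i)) * (∏ j, ketX s (a j))

/-- A single-qubit Pauli up to phase: `(x, z)` stands for `X^x Z^z`. Multiplication of Paulis
modulo phase is addition of these pairs. -/
abbrev Pauli : Type := ZMod 2 × ZMod 2

/-- The matrix of the Pauli string `∏_w X_w^{x_w} Z_w^{z_w}` (a representative modulo phase). -/
def pauliMatrix {W : Type} [Fintype W] [DecidableEq W] (p : W → Pauli) :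
    Matrix (W → ZMod 2) (W → ZMod 2) ℂ :=
  Matrix.of fun b a => if b = (fun w => a w + (p w).1) then sgn (∑ w, (p w).2 * a w) else 0

/-! ### Circuits -/

/-- The operations of a circuit on the wires `W` with measurement outcomes `k : Fin m`. -/
inductive Gate (W : Type) (m : ℕ) : Type
  /-- prepare a new qubit in `|0⟩` -/
  | prepZ (q : W)
  /-- prepare a new qubit in `|+⟩` -/
  | prepX (q : W)
  /-- CNOT with the given control and target -/
  | cnot (control target : W)
  /-- destructive measurement in the basis `|0⟩, |1⟩`, with outcome variable `k` -/
  | measZ (q : W) (k : Fin m)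
  /-- destructive measurement in the basis `|+⟩, |-⟩`, with outcome variable `k` -/
  | measX (q : W) (k : Fin m)
  /-- the correction `Z^k` on qubit `q`, controlled by the outcome variable `k` -/
  | corrZ (q : W) (k : Fin m)
  /-- non-destructive measurement of the Pauli `∏_{q ∈ s} Z_q`, with outcome variable `k` -/
  | measPauliZ (s : Finset W) (k : Fin m)
  /-- prepare four new qubits in the cat state `|++++⟩ + |----⟩` -/
  | catState (q : Fin 4 → W)
  /-- the cat-like linear map `|++⟩⟨++| + |--⟩⟨--|` on two qubits -/
  | catLike (q : Fin 2 → W)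

namespace Gate

variable {W : Type} [Fintype W] [DecidableEq W] {m : ℕ}

/-- The linear map of an operation for the measurement outcomes `o`, as a matrix with rows indexed
by output and columns by input basis states of all wires. A wire that carries no qubit at the
moment (before its preparation or after its destructive measurement) is assigned the value `0`. -/
def toMatrix (o : Fin m → ZMod 2) : Gate W m → Matrix (W → ZMod 2) (W → ZMod 2) ℂ
  | prepZ q => Matrix.of fun b a => if a q = 0 ∧ b = a then 1 else 0
  | prepX q => Matrix.of fun b a => if a q = 0 ∧ Function.update b q 0 = a then ketX 0 (b q) else 0
  | cnot c t => Matrix.of fun b a => if b = Function.update a t (a t + a c) then 1 else 0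
  | measZ q k => Matrix.of fun b a => if a q = o k ∧ b = Function.update a q 0 then 1 else 0
  | measX q k => Matrix.of fun b a => if b = Function.update a q 0 then ketX (o k) (a q) else 0
  | corrZ q k => Matrix.of fun b a => if b = a then sgn (o k * a q) else 0
  | measPauliZ s k => Matrix.of fun b a => if b = a then (1 + sgn (o k) * sgn (∑ q ∈ s, a q)) / 2 else 0
  | catState q => Matrix.of fun b a =>
      if (∀ i, a (q i) = 0) ∧ (∀ w, (∀ i, w ≠ q i) → b w = a w) then
        xSpider (fun i : Fin 0 => i.elim0) (fun i => b (q i)) else 0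
  | catLike q => Matrix.of fun b a =>
      if ∀ w, (∀ i, w ≠ q i) → b w = a w then
        xSpider (fun i => a (q i)) (fun i => b (q i)) else 0

/-- The output wires of an operation. -/
def outputs : Gate W m → Finset W
  | prepZ q => {q}
  | prepX q => {q}
  | cnot c t => {c, t}
  | measZ _ _ => ∅
  | measX _ _ => ∅
  | corrZ q _ => {q}
  | measPauliZ s _ => s
  | catState q => Finset.univ.image q
  | catLike q => Finset.univ.image q

/-- The wires carrying a qubit after the operation, given those carrying a qubit before it. -/
def updateLive (live : Finset W) : Gate W m → Finset W
  | prepZ q => insert q live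
  | prepX q => insert q live
  | measZ q _ => live.erase q
  | measX q _ => live.erase q
  | catState q => live ∪ Finset.univ.image q
  | _ => live

/-- The operation makes sense when exactly the wires in `live` carry a qubit. -/
def Legal (live : Finset W) : Gate W m → Prop
  | prepZ q => q ∉ live
  | prepX q => q ∉ live
  | cnot c t => c ∈ live ∧ t ∈ live ∧ c ≠ t
  | measZ q _ => q ∈ live
  | measX q _ => q ∈ live
  | corrZ q _ => q ∈ live
  | measPauliZ s _ => s ⊆ live
  | catState q => Function.Injective q ∧ ∀ i, q i ∉ live
  | catLike q => Function.Injective q ∧ ∀ i, q i ∈ live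

/-- The outcome variable produced by the operation, if it is a measurement. -/
def outcome : Gate W m → Option (Fin m)
  | measZ _ k => some k
  | measX _ k => some k
  | measPauliZ _ k => some k
  | _ => none

/-- The elementary physical operations: preparation and destructive measurement of a single qubit,
CNOT, and classically controlled single-qubit Paulis. -/
def Elementary : Gate W m → Prop
  | measPauliZ _ _ => False
  | catState _ => False
  | catLike _ => False
  | _ => True

end Gate

/-- How far an operation is idealised in the noise model. -/
inductive Level : Type
  | noisy
  | faultTolerant
  | faultFree

/-- An operation together with its idealisation level. -/
structure Step (W : Type) (m : ℕ) where
  gate : Gate W m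
  level : Level

/-- A circuit on `d` data qubits (its inputs and outputs, in this order) and `a` auxiliary qubits,
with `m` measurement outcomes, reporting `r` classical bits. The operations are performed one per
time step. Reported bit `j` is the parity of the outcomes in `readout j`; `checks` is a list of
linear constraints `⊕_{k ∈ S} k = b` imposed on the outcomes. -/
structure Circuit (d a m r : ℕ) where
  steps : List (Step (Fin d ⊕ Fin a) m)
  readout : Fin r → Finset (Fin m)
  checks : List (Finset (Fin m) × ZMod 2) := []

/-- Faults on circuits with wires `W`: a Pauli (modulo phase) for every wire at every time; time `t`
is directly before operation number `t` (counted from `0`) and directly after operation number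
`t - 1`. Only wires carrying a qubit at a time up to the end of the circuit are fault locations:
the noise model below generates no other faults. Multiplication of faults is written additively. -/
abbrev Fault (W : Type) : Type := ℕ → W → Pauli

/-- The fault acting as the Pauli string `p` at time `t` only. -/
def faultAt {W : Type} (t : ℕ) (p : W → Pauli) : Fault W := fun t' w => if t' = t then p w else 0

/-- The Pauli string acting as `p` on wire `q` only. -/
def pauliAt {W : Type} [DecidableEq W] (q : W) (p : Pauli) : W → Pauli :=
  fun w => if w = q then p else 0

/-- The linear map of a list of operations, the first of which is performed at time `t`, with the
fault `F` applied, for the outcomes `o`. -/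
def runSteps {W : Type} [Fintype W] [DecidableEq W] {m : ℕ} (F : Fault W) (o : Fin m → ZMod 2) :
    ℕ → List (Step W m) → Matrix (W → ZMod 2) (W → ZMod 2) ℂ
  | t, [] => pauliMatrix (F t)
  | t, s :: rest => runSteps F o (t + 1) rest * s.gate.toMatrix o * pauliMatrix (F t)

namespace Circuit

variable {d a m r : ℕ}

/-- The linear map from the data qubits to the data qubits which the circuit with fault `F` performs
when the measurement outcomes are `o`. -/
def kraus (C : Circuit d a m r) (F : Fault (Fin d ⊕ Fin a)) (o : Fin m → ZMod 2) :
    Matrix (Fin d → ZMod 2) (Fin d → ZMod 2) ℂ :=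
  Matrix.of fun y x => runSteps F o 0 C.steps (Sum.elim y 0) (Sum.elim x 0)

/-- The outcomes `o` satisfy the constraints of the circuit. -/
def Satisfies (C : Circuit d a m r) (o : Fin m → ZMod 2) : Prop :=
  ∀ c ∈ C.checks, ∑ k ∈ c.1, o k = c.2

/-- The circuit is total: without faults, its constraints hold for all possible outcomes. -/
def Total (C : Circuit d a m r) : Prop :=
  ∀ o : Fin m → ZMod 2, C.kraus 0 o ≠ 0 → C.Satisfies o

open Classical in
/-- The (unnormalised) effect of the faulty circuit on a density matrix `ρ` of the data qubits when
the bits `v` are reported (and the constraints hold). -/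
def branch (C : Circuit d a m r) (F : Fault (Fin d ⊕ Fin a)) (v : Fin r → ZMod 2)
    (ρ : Matrix (Fin d → ZMod 2) (Fin d → ZMod 2) ℂ) :
    Matrix (Fin d → ZMod 2) (Fin d → ZMod 2) ℂ :=
  ∑ o : Fin m → ZMod 2, if (∀ j, ∑ k ∈ C.readout j, o k = v j) ∧ C.Satisfies o then
    C.kraus F o * ρ * (C.kraus F o)ᴴ else 0

/-! ### Noise -/

/-- The wires carrying a qubit at time `t`. -/
def live (C : Circuit d a m r) (t : ℕ) : Finset (Fin d ⊕ Fin a) :=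
  (C.steps.take t).foldl (fun l s => s.gate.updateLive l) (Finset.univ.image Sum.inl)

/-- The atomic faults of circuit-level noise, with operations idealised according to their level.
(For a destructive single-qubit measurement, the measurement flip is a qubit flip on its input.) -/
inductive Noise (C : Circuit d a m r) : Fault (Fin d ⊕ Fin a) → Prop
  /-- a Pauli on one wire at one time -/
  | qubitFlip (t : ℕ) (ht : t ≤ C.steps.length) (q : Fin d ⊕ Fin a) (hq : q ∈ C.live t)
      (p : Pauli) : Noise C (faultAt t (pauliAt q p))
  /-- a noisy operation: any Pauli string on its outputs -/
  | gateFault (t : ℕ) (g : Gate (Fin d ⊕ Fin a) m) (hg : C.steps[t]? = some ⟨g, Level.noisy⟩)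
      (p : Fin d ⊕ Fin a → Pauli) (hp : ∀ w, w ∉ g.outputs → p w = 0) :
      Noise C (faultAt (t + 1) p)
  /-- a noisy Pauli measurement: an anticommuting Pauli `f` directly before and after the
  measurement, and any Pauli string on its outputs -/
  | measFlip (t : ℕ) (s : Finset (Fin d ⊕ Fin a)) (k : Fin m)
      (hg : C.steps[t]? = some ⟨Gate.measPauliZ s k, Level.noisy⟩)
      (f : Fin d ⊕ Fin a → Pauli) (hf : ∀ w, w ∉ s → f w = 0) (hanti : ∑ w ∈ s, (f w).1 = 1)
      (p : Fin d ⊕ Fin a → Pauli) (hp : ∀ w, w ∉ s → p w = 0) :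
      Noise C (faultAt t f + faultAt (t + 1) (f + p))
  /-- a fault-tolerant Pauli measurement: an anticommuting Pauli `f` directly before and after the
  measurement, and a (possibly trivial) Pauli on one of its outputs -/
  | measFlipFT (t : ℕ) (s : Finset (Fin d ⊕ Fin a)) (k : Fin m)
      (hg : C.steps[t]? = some ⟨Gate.measPauliZ s k, Level.faultTolerant⟩)
      (f : Fin d ⊕ Fin a → Pauli) (hf : ∀ w, w ∉ s → f w = 0) (hanti : ∑ w ∈ s, (f w).1 = 1)
      (q : Fin d ⊕ Fin a) (hq : q ∈ s) (p : Pauli) :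
      Noise C (faultAt t f + faultAt (t + 1) (f + pauliAt q p))

/-- The possible faults: the group generated by the atomic faults. -/
def faults (C : Circuit d a m r) : AddSubgroup (Fault (Fin d ⊕ Fin a)) :=
  AddSubgroup.closure {F | C.Noise F}

/-- The weight of a possible fault: the least number of atomic faults whose product it is. -/
def wt (C : Circuit d a m r) (F : Fault (Fin d ⊕ Fin a)) : ℕ :=
  sInf {n | ∃ l : List (Fault (Fin d ⊕ Fin a)), l.length = n ∧ (∀ A ∈ l, C.Noise A) ∧ l.sum = F}

/-- A fault is detectable if, for some set of measurements whose outcome parity is predetermined in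
the fault-free circuit, the fault flips that parity. -/
def Detectable (C : Circuit d a m r) (F : Fault (Fin d ⊕ Fin a)) : Prop :=
  ∃ (S : Finset (Fin m)) (b : ZMod 2),
    (∀ o : Fin m → ZMod 2, C.kraus 0 o ≠ 0 → ∑ k ∈ S, o k = b) ∧
    (∀ o : Fin m → ZMod 2, C.kraus F o ≠ 0 → ∑ k ∈ S, o k = b + 1)

/-! ### Fault equivalence -/

variable {a₁ m₁ a₂ m₂ : ℕ}

/-- The faulty circuits `C₁^{F₁}` and `C₂^{F₂}` are equal: they act in the same way on the data
qubits for all reported bits, up to a common positive scalar. -/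
def SameAction (C₁ : Circuit d a₁ m₁ r) (F₁ : Fault (Fin d ⊕ Fin a₁))
    (C₂ : Circuit d a₂ m₂ r) (F₂ : Fault (Fin d ⊕ Fin a₂)) : Prop :=
  ∃ c : ℝ, 0 < c ∧ ∀ v ρ, C₁.branch F₁ v ρ = (c : ℂ) • C₂.branch F₂ v ρ

/-- Every undetectable fault of weight less than `w` on `C₁` has a corresponding fault on `C₂`. -/
def FaultsCovered (w : ℕ) (C₁ : Circuit d a₁ m₁ r) (C₂ : Circuit d a₂ m₂ r) : Prop :=
  ∀ F₁ ∈ C₁.faults, C₁.wt F₁ < w →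
    C₁.Detectable F₁ ∨ ∃ F₂ ∈ C₂.faults, C₂.wt F₂ ≤ C₁.wt F₁ ∧ SameAction C₁ F₁ C₂ F₂

/-- `w`-fault equivalence. -/
def FaultEquivalentUpTo (w : ℕ) (C₁ : Circuit d a₁ m₁ r) (C₂ : Circuit d a₂ m₂ r) : Prop :=
  FaultsCovered w C₁ C₂ ∧ FaultsCovered w C₂ C₁

/-- Fault equivalence. -/
def FaultEquivalent (C₁ : Circuit d a₁ m₁ r) (C₂ : Circuit d a₂ m₂ r) : Prop :=
  ∀ w, FaultEquivalentUpTo w C₁ C₂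

/-! ### Resources and implementability -/

/-- The number of auxiliary qubits that the circuit uses. -/
def auxCount (C : Circuit d a m r) : ℕ :=
  (Finset.univ.filter fun j : Fin a =>
    Sum.inr j ∈ (Finset.range (C.steps.length + 1)).biUnion C.live).card

/-- The number of measurements that the circuit performs. -/
def measCount (C : Circuit d a m r) : ℕ :=
  C.steps.countP fun s : Step (Fin d ⊕ Fin a) m => s.gate.outcome.isSome

/-- Operations are only applied to wires carrying a qubit and new qubits only put on free wires, all
auxiliary wires are free at the end, and every outcome variable belongs to one measurement. -/
def WellFormed (C : Circuit d a m r) : Prop :=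
  (∀ (t : ℕ) (s : Step (Fin d ⊕ Fin a) m), C.steps[t]? = some s → s.gate.Legal (C.live t)) ∧
  C.live C.steps.length = Finset.univ.image Sum.inl ∧
  ∀ k : Fin m, C.steps.countP (fun s : Step (Fin d ⊕ Fin a) m => decide (s.gate.outcome = some k)) = 1

/-- The circuit is implementable: it is well-formed, consists of elementary operations, idealises
none of them, and controls corrections only by outcomes of earlier measurements. -/
def Implementable (C : Circuit d a m r) : Prop :=
  C.WellFormed ∧
  (∀ s ∈ C.steps, s.gate.Elementary ∧ s.level = Level.noisy) ∧
  ∀ (t : ℕ) (q : Fin d ⊕ Fin a) (k : Fin m) (l : Level),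
    C.steps[t]? = some ⟨Gate.corrZ q k, l⟩ → ∃ t' < t, ∃ s, C.steps[t']? = some s ∧ s.gate.outcome = some k

end Circuit

/-! ### The circuits -/

/-- Data wire `i`. -/
abbrev dat {d a : ℕ} (i : Fin d) : Fin d ⊕ Fin a := Sum.inl i

/-- Auxiliary wire `j`. -/
abbrev aux {d a : ℕ} (j : Fin a) : Fin d ⊕ Fin a := Sum.inr j

/-- A non-idealised operation. -/
abbrev noisy {W : Type} {m : ℕ} (g : Gate W m) : Step W m := ⟨g, Level.noisy⟩

/-- A fault-free operation. -/
abbrev ideal {W : Type} {m : ℕ} (g : Gate W m) : Step W m := ⟨g, Level.faultFree⟩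

/-- The specification: a fault-tolerant measurement of `Z ⊗ Z ⊗ Z ⊗ Z` on the data qubits, reporting
its outcome. -/
def zzzzMeasurement : Circuit 4 0 1 1 where
  steps := [⟨.measPauliZ (Finset.univ.image dat) 0, Level.faultTolerant⟩]
  readout := fun _ => {0}

/-- The circuit fault-tolerantly performs a syndrome measurement of type `ZZZZ`. -/
def FaultTolerantZZZZ {a m : ℕ} (C : Circuit 4 a m 1) : Prop :=
  zzzzMeasurement.FaultEquivalent C

/-- Shor-style syndrome measurement: a fault-free cat state on four auxiliary qubits, a CNOT from
each data qubit to its own auxiliary qubit, and measurements of the auxiliary qubits. The reported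
bit is the parity of the four outcomes. -/
def shorCircuit : Circuit 4 4 4 1 where
  steps := [
    ideal (.catState ![aux 0, aux 1, aux 2, aux 3]),
    noisy (.cnot (dat 0) (aux 0)),
    noisy (.cnot (dat 1) (aux 1)),
    noisy (.cnot (dat 2) (aux 2)),
    noisy (.cnot (dat 3) (aux 3)),
    noisy (.measZ (aux 0) 0),
    noisy (.measZ (aux 1) 1),
    noisy (.measZ (aux 2) 2),
    noisy (.measZ (aux 3) 3)]
  readout := fun _ => {0, 1, 2, 3}

/-- The optimised circuit with the fault-free cat-like map. The reported bit is the parity of the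
two outcomes. -/
def optimisedCircuit : Circuit 4 2 2 1 where
  steps := [
    noisy (.prepZ (aux 0)),
    noisy (.prepZ (aux 1)),
    noisy (.cnot (dat 0) (aux 0)),
    noisy (.cnot (dat 1) (aux 1)),
    ideal (.catLike ![aux 0, aux 1]),
    noisy (.cnot (dat 2) (aux 0)),
    noisy (.cnot (dat 3) (aux 1)),
    noisy (.measZ (aux 0) 0),
    noisy (.measZ (aux 1) 1)]
  readout := fun _ => {0, 1}

/-- The fault-free cat-like map as a circuit on two qubits. -/
def catLikeCircuit : Circuit 2 0 0 0 where
  steps := [ideal (.catLike ![dat 0, dat 1])]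
  readout := fun j => j.elim0

/-- The measurement of `X ⊗ X` on `p, q` using a bare auxiliary qubit `b`. -/
def xxMeasurement {W : Type} {m : ℕ} (b p q : W) (k : Fin m) : List (Step W m) :=
  [noisy (.prepX b), noisy (.cnot b p), noisy (.cnot b q), noisy (.measX b k)]

/-- The implementation of the cat-like map by two `XX` measurements with equal outcomes `0`, `1`
and `Z` corrections before and after. (The first correction precedes the measurement it depends
on.) -/
def catLikeImplementation : Circuit 2 1 2 0 where
  steps :=
    [noisy (.corrZ (dat 0) 0)] ++
    xxMeasurement (aux 0) (dat 0) (dat 1) 0 ++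
    xxMeasurement (aux 0) (dat 0) (dat 1) 1 ++
    [noisy (.corrZ (dat 0) 1)]
  readout := fun j => j.elim0
  checks := [({0, 1}, 0)]

/-- The optimised circuit with the cat-like map implemented by two `XX` measurements (outcomes
`0`, `1`, required to be equal) using one further auxiliary qubit, which is re-prepared in between;
the first correction is applied after the measurement it depends on, to a data qubit. The reported
bit is the parity of the outcomes `2`, `3`. -/
def completeCircuit : Circuit 4 3 4 1 where
  steps :=
    [noisy (.prepZ (aux 0)),
     noisy (.prepZ (aux 1)),
     noisy (.cnot (dat 0) (aux 0)),
     noisy (.cnot (dat 1) (aux 1))] ++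
    xxMeasurement (aux 2) (aux 0) (aux 1) 0 ++
    [noisy (.corrZ (dat 0) 0)] ++
    xxMeasurement (aux 2) (aux 0) (aux 1) 1 ++
    [noisy (.corrZ (aux 0) 1),
     noisy (.cnot (dat 2) (aux 0)),
     noisy (.cnot (dat 3) (aux 1)),
     noisy (.measZ (aux 0) 2),
     noisy (.measZ (aux 1) 3)]
  readout := fun _ => {2, 3}
  checks := [({0, 1}, 0)]

end FaultEq

end

/-! Every operation here lets a Pauli in front of it be exchanged, up to sign, for a Pauli behind
it, at the price of flipping at most one bit, its sign parameter: a measurement outcome, or the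
eigenvalue of `XX` that a cat-like map selects. A faulty circuit is therefore, up to sign, a Pauli
string after the fault-free circuit with some sign parameters flipped, and both the string and the
flips depend additively on the fault (`Gate.signed_mul_pauliMatrix`, `Circuit.kraus_upToSign`).

Evaluated for arbitrary sign parameters, each circuit is zero or a scalar times a Pauli string times
a projection (`NormalForm`), onto an eigenspace of `ZZZZ` for the measurements and of `XX` for the
cat-like maps. Each fault thus gets an additive syndrome bit and an additive effect: a Pauli string
on the data and a flip of the projection. A nonzero syndrome makes the fault detectable; with zero
syndrome the effect, up to the stabiliser `ZZZZ` or `XX`, determines the action on the data.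

Fault equivalence becomes a comparison of effects. Let `R` contain the effects of all atomic faults
of syndrome zero, let any two atomic faults of nonzero syndrome together have the effect of two
members of `R`, and let one atomic fault suffice to realise any member of `R`. In a fault of weight
`n` and syndrome zero the atoms of nonzero syndrome pair up, so the effect is a sum of at most `n`
members of `R`, which the other circuit realises with as many atoms (`NoiseAnalysis.faultsCovered`).

For the `ZZZZ` measurements, `R` consists of the Paulis on at most one data qubit up to `ZZZZ`, with
or without a flip of the reported bit. The delicate errors are `Z` on auxiliary qubits. Directly
before the cat-like map, `Z` on `aux 0` selects the wrong eigenvalue of `XX`, which amounts to `Z`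
on data 0 and 2, and the next CNOT propagates it to data 2: only `Z` on data 0 remains. For `aux 1`
the result is `Z` on data 0, 2 and 3, which up to `ZZZZ` is `Z` on data 1. In the complete circuit a
single wrong `XX` outcome violates the constraint. Atoms of nonzero syndrome act on the data by `Z`
strings, and up to `ZZZZ` every such string has weight at most two, so a pair of them does no more
than two single-qubit Paulis. For the cat-like maps, `R` consists of the single-qubit Paulis before
or after the map, and two of these produce any effect. That the atoms of each circuit obey these
rules is a finite check by evaluation. -/

noncomputable section

namespace FaultEq

/-! ### Signs and Pauli matrices -/

@[simp] theorem sgn_zero : sgn 0 = 1 := if_pos rfl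

theorem sgn_add : ∀ a b : ZMod 2, sgn (a + b) = sgn a * sgn b := by
  have h : (1 : ZMod 2) + 1 = 0 := by decide
  have h01 : ∀ a : ZMod 2, a = 0 ∨ a = 1 := by decide
  intro a b
  rcases h01 a with rfl | rfl <;> rcases h01 b with rfl | rfl <;> simp [sgn, h]

theorem sgn_mul_self (a : ZMod 2) : sgn a * sgn a = 1 := by
  rw [← sgn_add, CharTwo.add_self_eq_zero, sgn_zero]

theorem star_sgn (a : ZMod 2) : star (sgn a) = sgn a := by
  unfold sgn; split_ifs <;> simp

section Pauli

variable {W : Type}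

theorem add_self_assignment (x : W → ZMod 2) : x + x = 0 := by
  funext w
  exact CharTwo.add_self_eq_zero _

theorem eq_add_comm_iff (b a x : W → ZMod 2) : b = a + x ↔ a = b + x := by
  constructor <;> rintro rfl <;> rw [add_assoc, add_self_assignment, add_zero]

/-- The positions of the `X` factors. -/
def xPart (p : W → Pauli) : W → ZMod 2 := fun w => (p w).1

/-- The positions of the `Z` factors. -/
def zPart (p : W → Pauli) : W → ZMod 2 := fun w => (p w).2

variable [Fintype W] [DecidableEq W]

theorem pauliMatrix_apply (p : W → Pauli) (b a : W → ZMod 2) :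
    pauliMatrix p b a = if b = a + xPart p then sgn (∑ w, zPart p w * a w) else 0 := rfl

theorem mul_pauliMatrix_apply (M : Matrix (W → ZMod 2) (W → ZMod 2) ℂ) (p : W → Pauli)
    (b a : W → ZMod 2) :
    (M * pauliMatrix p) b a = M b (a + xPart p) * sgn (∑ w, zPart p w * a w) := by
  rw [Matrix.mul_apply, Finset.sum_eq_single (a + xPart p)]
  · rw [pauliMatrix_apply, if_pos rfl]
  · intro c _ hc
    rw [pauliMatrix_apply, if_neg hc, mul_zero]
  · simp

theorem pauliMatrix_mul_apply (M : Matrix (W → ZMod 2) (W → ZMod 2) ℂ) (p : W → Pauli)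
    (b a : W → ZMod 2) :
    (pauliMatrix p * M) b a
      = sgn (∑ w, zPart p w * (b + xPart p) w) * M (b + xPart p) a := by
  rw [Matrix.mul_apply, Finset.sum_eq_single (b + xPart p)]
  · rw [pauliMatrix_apply, if_pos ((eq_add_comm_iff _ _ _).2 rfl)]
  · intro c _ hc
    rw [pauliMatrix_apply, if_neg (fun h => hc ((eq_add_comm_iff _ _ _).1 h)), zero_mul]
  · simp

theorem pauliMatrix_zero : pauliMatrix (0 : W → Pauli) = 1 := by
  ext b a
  simp [pauliMatrix, Matrix.one_apply]

/-- Equality of matrices up to a sign. -/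
def UpToSign {I J : Type} (M N : Matrix I J ℂ) : Prop := ∃ u : ZMod 2, M = sgn u • N

namespace UpToSign

variable {I J K : Type} {M N : Matrix I J ℂ}

theorem of_eq (h : M = N) : UpToSign M N := ⟨0, by simp [h]⟩

theorem trans {L : Matrix I J ℂ} : UpToSign M N → UpToSign N L → UpToSign M L := by
  rintro ⟨u, rfl⟩ ⟨v, rfl⟩
  exact ⟨u + v, by rw [sgn_add, smul_smul]⟩

theorem symm : UpToSign M N → UpToSign N M := by
  rintro ⟨u, rfl⟩
  exact ⟨u, by rw [smul_smul, sgn_mul_self, one_smul]⟩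

theorem mul_left [Fintype I] (A : Matrix K I ℂ) : UpToSign M N → UpToSign (A * M) (A * N) := by
  rintro ⟨u, rfl⟩
  exact ⟨u, by rw [Matrix.mul_smul]⟩

theorem mul_right [Fintype J] (A : Matrix J K ℂ) : UpToSign M N → UpToSign (M * A) (N * A) := by
  rintro ⟨u, rfl⟩
  exact ⟨u, by rw [Matrix.smul_mul]⟩

theorem smul (c : ℂ) : UpToSign M N → UpToSign (c • M) (c • N) := by
  rintro ⟨u, rfl⟩
  exact ⟨u, smul_comm _ _ _⟩

end UpToSign

/-- The sign collects one factor for every wire on which a `Z` of `p` passes an `X` of `q`. -/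
theorem pauliMatrix_mul (p q : W → Pauli) :
    UpToSign (pauliMatrix p * pauliMatrix q) (pauliMatrix (p + q)) := by
  refine ⟨∑ w, zPart p w * xPart q w, ?_⟩
  ext b a
  rw [mul_pauliMatrix_apply, Matrix.smul_apply, smul_eq_mul, pauliMatrix_apply, pauliMatrix_apply]
  have h : a + xPart q + xPart p = a + xPart (p + q) := by
    funext w
    simp only [Pi.add_apply, Prod.fst_add, xPart]
    ring
  rw [h]
  split_ifs
  · rw [← sgn_add, ← sgn_add, ← Finset.sum_add_distrib, ← Finset.sum_add_distrib]
    congr 1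
    refine Finset.sum_congr rfl fun w _ => ?_
    simp only [Pi.add_apply, Prod.snd_add, xPart, zPart]
    ring
  · simp

end Pauli

/-! ### Moving Paulis through operations -/

namespace Gate

section Frame

variable {W : Type} {m : ℕ}

/-- The sign parameter of an operation for given outcomes. -/
def setting (o : Fin m → ZMod 2) : Gate W m → ZMod 2
  | measZ _ k => o k
  | measX _ k => o k
  | corrZ _ k => o k
  | measPauliZ _ k => o k
  | _ => 0

/-- Whether `p` before the operation flips its sign parameter. -/
def flip (p : W → Pauli) : Gate W m → ZMod 2
  | measZ q _ => (p q).1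
  | measX q _ => (p q).2
  | measPauliZ S _ => ∑ q ∈ S, (p q).1
  | catLike q => (p (q 0)).2 + (p (q 1)).2
  | _ => 0

theorem flip_add (p p' : W → Pauli) (g : Gate W m) : g.flip (p + p') = g.flip p + g.flip p' := by
  cases g <;>
    simp only [flip, Pi.add_apply, Prod.fst_add, Prod.snd_add, Finset.sum_add_distrib, add_zero]
  ring

/-- The operation is nondegenerate, and `p` is trivial on the qubits that it prepares. -/
def Passes (p : W → Pauli) : Gate W m → Prop
  | prepZ q => p q = 0
  | prepX q => p q = 0
  | catState q => ∀ i, p (q i) = 0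
  | cnot c t => c ≠ t
  | catLike q => q 0 ≠ q 1
  | _ => True

theorem Passes.add {p p' : W → Pauli} {g : Gate W m} (h : g.Passes p) (h' : g.Passes p') :
    g.Passes (p + p') := by
  cases g <;> simp_all [Passes]

variable [DecidableEq W]

/-- The Pauli string after the operation equivalent to `p` before it. -/
def push (p : W → Pauli) : Gate W m → W → Pauli
  | cnot c t => fun w =>
      p w + (if w = t then ((p c).1, 0) else 0) + (if w = c then (0, (p t).2) else 0)
  | measZ q _ => fun w => if w = q then 0 else p w
  | measX q _ => fun w => if w = q then 0 else p w
  | _ => p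

theorem push_add (p p' : W → Pauli) (g : Gate W m) : g.push (p + p') = g.push p + g.push p' := by
  cases g <;> try rfl
  all_goals
    funext w
    simp only [push, Pi.add_apply, Prod.fst_add, Prod.snd_add]
    split_ifs <;> ext <;> simp <;> ring

end Frame

variable {W : Type} [Fintype W] [DecidableEq W] {m : ℕ}

/-- The linear map of an operation with a single sign parameter: the outcome of a measurement, the
control bit of a correction, and the eigenvalue of `X ⊗ X` onto which a cat-like map projects. -/
def signed (s : ZMod 2) : Gate W m → Matrix (W → ZMod 2) (W → ZMod 2) ℂ
  | catLike q => Matrix.of fun b a =>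
      sgn (s * (a (q 0) + b (q 0))) * (catLike q : Gate W m).toMatrix 0 b a
  | prepZ q => (prepZ q : Gate W m).toMatrix 0
  | prepX q => (prepX q : Gate W m).toMatrix 0
  | cnot c t => (cnot c t : Gate W m).toMatrix 0
  | measZ q k => (measZ q k).toMatrix fun _ => s
  | measX q k => (measX q k).toMatrix fun _ => s
  | corrZ q k => (corrZ q k).toMatrix fun _ => s
  | measPauliZ S k => (measPauliZ S k).toMatrix fun _ => s
  | catState q => (catState q : Gate W m).toMatrix 0

/-- The real operations are members of the signed family; the cat-like map has parameter `0`, and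
only faults can produce the projection onto the other eigenspace. -/
theorem toMatrix_eq_signed (o : Fin m → ZMod 2) (g : Gate W m) :
    g.toMatrix o = g.signed (g.setting o) := by
  cases g <;> first | rfl | (ext; simp [signed, setting, toMatrix])

end Gate

/-! ### Amplitudes of spiders -/

theorem ketX_mul_ketX (s x y : ZMod 2) : ketX s x * ketX s y = sgn (s * (x + y)) / 2 := by
  have h : ((Real.sqrt 2 : ℝ) : ℂ) * (Real.sqrt 2 : ℝ) = 2 := by
    rw [← Complex.ofReal_mul, Real.mul_self_sqrt (by norm_num)]
    norm_num
  rw [ketX, ketX, div_mul_div_comm, h, ← sgn_add, mul_add]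

theorem sum_sgn_mul (x : ZMod 2) : ∑ s : ZMod 2, sgn (s * x) = if x = 0 then 2 else 0 := by
  have h := Fin.sum_univ_two fun s : ZMod 2 => sgn (s * x)
  rw [show (∑ s : ZMod 2, sgn (s * x)) = sgn (0 * x) + sgn (1 * x) from h, zero_mul, one_mul,
    sgn_zero, sgn]
  split_ifs <;> norm_num

/-- The sum over `s` is a character sum, which enforces even parity: the cat state is uniform on
even strings. -/
theorem xSpider_zero_four (a : Fin 0 → ZMod 2) (b : Fin 4 → ZMod 2) :
    xSpider a b = if b 0 + b 1 + b 2 + b 3 = 0 then 1 / 2 else 0 := by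
  have : ∀ s, (∏ i, ketX s (b i)) * (∏ j, ketX s (a j))
      = sgn (s * (b 0 + b 1 + b 2 + b 3)) / 4 := by
    intro s
    rw [Fin.prod_univ_zero, Fin.prod_univ_four, mul_one, ketX_mul_ketX, mul_assoc, ketX_mul_ketX,
      div_mul_div_comm, ← sgn_add]
    ring_nf
  simp only [xSpider, this]
  rw [← Finset.sum_div, sum_sgn_mul]
  split_ifs <;> norm_num

/-- The same character sum shows that the cat-like map is `(1 + XX) / 2`: both bits flip or neither
does. -/
theorem xSpider_two_two (a b : Fin 2 → ZMod 2) :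
    xSpider a b = if a 0 + b 0 = a 1 + b 1 then 1 / 2 else 0 := by
  have : ∀ s, (∏ i, ketX s (b i)) * (∏ j, ketX s (a j))
      = sgn (s * (a 0 + b 0 + (a 1 + b 1))) / 4 := by
    intro s
    rw [Fin.prod_univ_two, Fin.prod_univ_two, ketX_mul_ketX, ketX_mul_ketX,
      div_mul_div_comm, ← sgn_add]
    ring_nf
  simp only [xSpider, this, ← CharTwo.add_eq_zero (a := a 0 + b 0)]
  rw [← Finset.sum_div, sum_sgn_mul]
  split_ifs <;> norm_num

/-! ### Moving Paulis through single operations -/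

theorem UpToSign.of_entries {W : Type} [Fintype W] [DecidableEq W]
    {p p' : W → Pauli} {M M' : Matrix (W → ZMod 2) (W → ZMod 2) ℂ}
    (u : ZMod 2) (h : ∀ b a, M b (a + xPart p) * sgn (∑ w, zPart p w * a w)
      = sgn u * (sgn (∑ w, zPart p' w * (b + xPart p') w) * M' (b + xPart p') a)) :
    UpToSign (M * pauliMatrix p) (pauliMatrix p' * M') := by
  refine ⟨u, ?_⟩
  ext b a
  rw [mul_pauliMatrix_apply, Matrix.smul_apply, pauliMatrix_mul_apply, h, smul_eq_mul]

namespace Gate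

section Erase

variable {W : Type} [DecidableEq W]

theorem zPart_erase (q : W) (p : W → Pauli) :
    zPart (fun w => if w = q then 0 else p w) = fun w => if w = q then 0 else zPart p w := by
  funext w; simp only [zPart]; split_ifs <;> rfl

theorem xPart_erase (q : W) (p : W → Pauli) :
    xPart (fun w => if w = q then 0 else p w) = fun w => if w = q then 0 else xPart p w := by
  funext w; simp only [xPart]; split_ifs <;> rfl

theorem update_add_eq_iff (q : W) (v : ZMod 2) (x a b : W → ZMod 2) :
    b = Function.update (a + x) q v ↔
      b + (fun w => if w = q then 0 else x w) = Function.update a q v := by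
  simp only [funext_iff, Pi.add_apply]
  refine forall_congr' fun w => ?_
  by_cases h : w = q
  · subst h; simp
  · simp only [h, ne_eq, not_false_eq_true, Function.update_of_ne, if_false, Pi.add_apply]
    constructor
    · intro e; rw [e, add_assoc, CharTwo.add_self_eq_zero, add_zero]
    · intro e; rw [← e, add_assoc, CharTwo.add_self_eq_zero, add_zero]

end Erase

variable {W : Type} [Fintype W] [DecidableEq W] {m : ℕ}

theorem sum_ite_zero_mul (q : W) (z c : W → ZMod 2) :
    ∑ w, z w * c w = z q * c q + ∑ w, (if w = q then 0 else z w) * c w := by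
  rw [← Finset.add_sum_erase _ _ (Finset.mem_univ q),
    ← Finset.add_sum_erase (a := q) (f := fun w => (if w = q then 0 else z w) * c w) _
      (Finset.mem_univ q), if_pos rfl, zero_mul, zero_add]
  congr 1
  refine Finset.sum_congr rfl fun w hw => ?_
  rw [if_neg (Finset.ne_of_mem_erase hw)]

theorem signed_measZ_mul (s : ZMod 2) (q : W) (k : Fin m) (p : W → Pauli) :
    UpToSign ((measZ q k : Gate W m).signed s * pauliMatrix p)
      (pauliMatrix ((measZ q k : Gate W m).push p) *
        (measZ q k : Gate W m).signed (s + (measZ q k : Gate W m).flip p)) := by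
  -- The sign comes from `Z` on the measured qubit, which has the value `s + (p q).1` before the
  -- Pauli.
  refine UpToSign.of_entries ((p q).2 * (s + (p q).1)) fun b a => ?_
  simp only [signed, toMatrix, Matrix.of_apply, push, flip, xPart_erase, zPart_erase,
    ← update_add_eq_iff]
  have h : (a + xPart p) q = s ↔ a q = s + (p q).1 := by
    rw [Pi.add_apply, xPart, eq_comm, ← CharTwo.sub_eq_add s, eq_sub_iff_add_eq, eq_comm]
  simp only [h]
  split_ifs with hc
  · obtain ⟨h1, h2⟩ := hc
    rw [update_add_eq_iff] at h2
    rw [h2, one_mul, mul_one, ← sgn_add, sum_ite_zero_mul q, h1]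
    congr 2
    refine Finset.sum_congr rfl fun w _ => ?_
    by_cases hw : w = q <;> simp [hw]
  · simp

theorem signed_measX_mul (s : ZMod 2) (q : W) (k : Fin m) (p : W → Pauli) :
    UpToSign ((measX q k : Gate W m).signed s * pauliMatrix p)
      (pauliMatrix ((measX q k : Gate W m).push p) *
        (measX q k : Gate W m).signed (s + (measX q k : Gate W m).flip p)) := by
  -- An `X` on the measured qubit contributes its eigenvalue `(-1)^s`.
  refine UpToSign.of_entries (s * (p q).1) fun b a => ?_
  simp only [signed, toMatrix, Matrix.of_apply, push, flip, xPart_erase, zPart_erase,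
    ← update_add_eq_iff]
  split_ifs with h2
  · rw [update_add_eq_iff] at h2
    rw [h2, ketX, ketX, div_mul_eq_mul_div, mul_div_assoc', mul_div_assoc', ← sgn_add, ← sgn_add,
      ← sgn_add, sum_ite_zero_mul q]
    congr 2
    have : ∑ w, (if w = q then 0 else zPart p w) * Function.update a q 0 w
        = ∑ w, (if w = q then 0 else zPart p w) * a w := by
      refine Finset.sum_congr rfl fun w _ => ?_
      by_cases hw : w = q <;> simp [hw]
    rw [this]
    simp only [Pi.add_apply, xPart, zPart]
    ring
  · simp

/-- A diagonal operation commutes with `Z` factors, so only the shift of its entries by the `X` part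
matters. -/
theorem signed_diagonal_mul {M M' : Matrix (W → ZMod 2) (W → ZMod 2) ℂ} {f f' : (W → ZMod 2) → ℂ}
    (hM : ∀ b a, M b a = if b = a then f a else 0) (hM' : ∀ b a, M' b a = if b = a then f' a else 0)
    (p : W → Pauli) (u : ZMod 2) (h : ∀ a, f (a + xPart p) = sgn u * f' a) :
    UpToSign (M * pauliMatrix p) (pauliMatrix p * M') := by
  refine UpToSign.of_entries u fun b a => ?_
  rw [hM, hM']
  by_cases hb : b = a + xPart p
  · rw [if_pos hb, if_pos ((eq_add_comm_iff _ _ _).1 hb).symm, h,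
      ← (eq_add_comm_iff _ _ _).1 hb]
    ring
  · rw [if_neg hb, if_neg fun hh => hb ((eq_add_comm_iff _ _ _).2 hh.symm)]
    simp

theorem signed_corrZ_mul (s : ZMod 2) (q : W) (k : Fin m) (p : W → Pauli) :
    UpToSign ((corrZ q k : Gate W m).signed s * pauliMatrix p)
      (pauliMatrix ((corrZ q k : Gate W m).push p) *
        (corrZ q k : Gate W m).signed (s + (corrZ q k : Gate W m).flip p)) := by
  refine signed_diagonal_mul (f := fun a => sgn (s * a q)) (f' := fun a => sgn ((s + 0) * a q))
    (fun _ _ => rfl) (fun _ _ => rfl) p (s * (p q).1) fun a => ?_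
  rw [← sgn_add, Pi.add_apply, xPart]
  ring_nf

theorem signed_measPauliZ_mul (s : ZMod 2) (S : Finset W) (k : Fin m) (p : W → Pauli) :
    UpToSign ((measPauliZ S k : Gate W m).signed s * pauliMatrix p)
      (pauliMatrix ((measPauliZ S k : Gate W m).push p) *
        (measPauliZ S k : Gate W m).signed (s + (measPauliZ S k : Gate W m).flip p)) := by
  refine signed_diagonal_mul (f := fun a => (1 + sgn s * sgn (∑ q ∈ S, a q)) / 2)
    (f' := fun a => (1 + sgn (s + ∑ q ∈ S, (p q).1) * sgn (∑ q ∈ S, a q)) / 2)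
    (fun _ _ => rfl) (fun _ _ => rfl) p 0 fun a => ?_
  simp only [Pi.add_apply, xPart, Finset.sum_add_distrib, sgn_add, sgn_zero]
  ring

theorem signed_prepZ_mul (s : ZMod 2) (q : W) (p : W → Pauli)
    (hp : (prepZ q : Gate W m).Passes p) :
    UpToSign ((prepZ q : Gate W m).signed s * pauliMatrix p)
      (pauliMatrix ((prepZ q : Gate W m).push p) *
        (prepZ q : Gate W m).signed (s + (prepZ q : Gate W m).flip p)) := by
  refine signed_diagonal_mul (f := fun a => if a q = 0 then 1 else 0)
    (f' := fun a => if a q = 0 then 1 else 0)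
    (fun b a => ?_) (fun b a => ?_) p 0 fun a => ?_
  · simp only [signed, toMatrix, Matrix.of_apply, ite_and]
    split_ifs <;> rfl
  · simp only [signed, toMatrix, Matrix.of_apply, ite_and]
    split_ifs <;> rfl
  · simp only [Passes] at hp
    simp [xPart, hp]

theorem signed_prepX_mul (s : ZMod 2) (q : W) (p : W → Pauli)
    (hp : (prepX q : Gate W m).Passes p) :
    UpToSign ((prepX q : Gate W m).signed s * pauliMatrix p)
      (pauliMatrix ((prepX q : Gate W m).push p) *
        (prepX q : Gate W m).signed (s + (prepX q : Gate W m).flip p)) := by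
  simp only [Passes] at hp
  refine UpToSign.of_entries 0 fun b a => ?_
  simp only [signed, toMatrix, Matrix.of_apply, push]
  have hx : xPart p q = 0 := by simp [xPart, hp]
  have hz : zPart p q = 0 := by simp [zPart, hp]
  have h : Function.update (b + xPart p) q 0 = a ↔ Function.update b q 0 = a + xPart p := by
    rw [eq_comm, update_add_eq_iff, eq_comm]
    have : (fun w => if w = q then 0 else xPart p w) = xPart p := by
      funext w; split_ifs with e
      · rw [e, hx]
      · rfl
    rw [this]
  simp only [h, Pi.add_apply, hx, add_zero]
  split_ifs with hc
  · rw [sgn_zero, one_mul, mul_comm]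
    congr 2
    rw [← h] at hc
    refine Finset.sum_congr rfl fun w _ => ?_
    by_cases hw : w = q
    · rw [hw, hz, zero_mul, zero_mul]
    · rw [← hc.2, Function.update_of_ne hw, Pi.add_apply]
  · simp

theorem signed_catState_mul (s : ZMod 2) (q : Fin 4 → W) (p : W → Pauli)
    (hp : (catState q : Gate W m).Passes p) :
    UpToSign ((catState q : Gate W m).signed s * pauliMatrix p)
      (pauliMatrix ((catState q : Gate W m).push p) *
        (catState q : Gate W m).signed (s + (catState q : Gate W m).flip p)) := by
  simp only [Passes] at hp
  refine UpToSign.of_entries 0 fun b a => ?_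
  simp only [signed, toMatrix, Matrix.of_apply, push]
  have hx : ∀ i, xPart p (q i) = 0 := by simp [xPart, hp]
  have hz : ∀ i, zPart p (q i) = 0 := by simp [zPart, hp]
  have h : ∀ w, b w = a w + xPart p w ↔ b w + xPart p w = a w := fun w => by
    rw [← CharTwo.sub_eq_add (b w), sub_eq_iff_eq_add]
  simp only [Pi.add_apply, hx, add_zero, h]
  split_ifs with hc
  · rw [sgn_zero, one_mul, mul_comm]
    congr 2
    refine Finset.sum_congr rfl fun w _ => ?_
    by_cases hw : ∃ i, w = q i
    · obtain ⟨i, rfl⟩ := hw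
      rw [hz, zero_mul, zero_mul]
    · rw [hc.2 w (not_exists.1 hw)]
  · simp

theorem signed_catLike_mul (s : ZMod 2) (q : Fin 2 → W) (p : W → Pauli)
    (hp : (catLike q : Gate W m).Passes p) :
    UpToSign ((catLike q : Gate W m).signed s * pauliMatrix p)
      (pauliMatrix ((catLike q : Gate W m).push p) *
        (catLike q : Gate W m).signed (s + (catLike q : Gate W m).flip p)) := by
  simp only [Passes] at hp
  refine UpToSign.of_entries 0 fun b a => ?_
  simp only [signed, toMatrix, Matrix.of_apply, push, flip, xSpider_two_two]
  have h : ∀ w, b w = (a + xPart p) w ↔ (b + xPart p) w = a w := fun w => by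
    rw [Pi.add_apply, Pi.add_apply, ← CharTwo.sub_eq_add (b w), sub_eq_iff_eq_add]
  simp only [h]
  by_cases hc : ∀ w, (∀ i, w ≠ q i) → (b + xPart p) w = a w
  swap
  · rw [if_neg hc, if_neg hc, mul_zero, zero_mul, mul_zero, mul_zero, mul_zero]
  rw [if_pos hc, if_pos hc]
  have e : ∀ w, (a + xPart p) w + b w = a w + (b + xPart p) w := fun w => by
    simp only [Pi.add_apply]; ring
  rw [e, e]
  split_ifs with hd
  -- Where the matrix entry is nonzero, input and output agree off the two qubits and differ by a
  -- common bit on both; the phases of `Z` cancel elsewhere and leave this bit times the flip of the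
  -- parameter.
  · have key : ∑ w, zPart p w * (b + xPart p) w + ∑ w, zPart p w * a w
        = (zPart p (q 0) + zPart p (q 1)) * (a (q 0) + (b + xPart p) (q 0)) := by
      rw [← Finset.sum_add_distrib, ← Finset.add_sum_erase _ _ (Finset.mem_univ (q 0)),
        ← Finset.add_sum_erase (a := q 1) _ _
          (Finset.mem_erase.2 ⟨hp.symm, Finset.mem_univ (q 1)⟩), Finset.sum_eq_zero]
      · linear_combination zPart p (q 1) * hd.symm
      · intro w hw
        simp only [Finset.mem_erase, ne_eq, Finset.mem_univ, and_true] at hw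
        rw [hc w (fun i => by fin_cases i; exacts [hw.2, hw.1]), CharTwo.add_self_eq_zero]
    rw [← eq_sub_iff_add_eq', CharTwo.sub_eq_add] at key
    rw [key]
    have e' : ∀ w, (p w).2 = zPart p w := fun _ => rfl
    simp only [e', add_mul, sgn_add, sgn_zero]
    ring
  · simp

theorem signed_cnot_mul (s : ZMod 2) (c t : W) (p : W → Pauli)
    (hp : (cnot c t : Gate W m).Passes p) :
    UpToSign ((cnot c t : Gate W m).signed s * pauliMatrix p)
      (pauliMatrix ((cnot c t : Gate W m).push p) *
        (cnot c t : Gate W m).signed (s + (cnot c t : Gate W m).flip p)) := by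
  simp only [Passes] at hp
  refine UpToSign.of_entries 0 fun b a => ?_
  simp only [signed, toMatrix, Matrix.of_apply]
  have hx : xPart ((cnot c t : Gate W m).push p)
      = fun w => xPart p w + if w = t then xPart p c else 0 := by
    funext w; simp only [xPart, push]; split_ifs <;> simp
  have hz : zPart ((cnot c t : Gate W m).push p)
      = fun w => zPart p w + if w = c then zPart p t else 0 := by
    funext w; simp only [zPart, push]; split_ifs <;> simp
  have hu : ∀ a : W → ZMod 2, Function.update a t (a t + a c)
      = fun w => a w + if w = t then a c else 0 := by
    intro a; funext w
    by_cases h : w = t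
    · subst h; simp
    · simp [h]
  rw [hx, hz, hu, hu]
  have h : b = (fun w => (a + xPart p) w + if w = t then (a + xPart p) c else 0) ↔
      b + (fun w => xPart p w + if w = t then xPart p c else 0)
        = fun w => a w + if w = t then a c else 0 := by
    rw [eq_comm (a := b + _), ← eq_add_comm_iff]
    have : (fun w => (a + xPart p) w + if w = t then (a + xPart p) c else 0)
      = (fun w => a w + if w = t then a c else 0) +
        (fun w => xPart p w + if w = t then xPart p c else 0) := by
      funext w
      simp only [Pi.add_apply]
      split_ifs <;> ring
    rw [this]
  by_cases hb : b = fun w => (a + xPart p) w + if w = t then (a + xPart p) c else 0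
  · rw [if_pos hb, if_pos (h.1 hb), h.1 hb, one_mul, sgn_zero, one_mul, mul_one]
    congr 1
    -- The `Z` copied from target to control and the bit added to the target contribute the same
    -- term, so the two cancel modulo 2.
    have e : ∀ w, (zPart p w + if w = c then zPart p t else 0) * (a w + if w = t then a c else 0)
        = zPart p w * a w + ((if w = t then zPart p t * a c else 0)
          + if w = c then zPart p t * a c else 0) := by
      intro w
      by_cases h1 : w = c
      · subst h1; simp [hp]; ring
      · by_cases h2 : w = t
        · subst h2; simp [h1]; ring
        · simp [h1, h2]
    simp only [e, Finset.sum_add_distrib, Finset.sum_ite_eq', Finset.mem_univ, if_true,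
      CharTwo.add_self_eq_zero, add_zero]
  · rw [if_neg hb, if_neg fun hh => hb (h.2 hh)]
    simp

/-- The single-step rule on which all fault propagation rests. `Passes` is needed because the
preparations test their wire for the value `0`, which an `X` there would change. -/
theorem signed_mul_pauliMatrix (s : ZMod 2) (p : W → Pauli) (g : Gate W m) (hp : g.Passes p) :
    UpToSign (g.signed s * pauliMatrix p) (pauliMatrix (g.push p) * g.signed (s + g.flip p)) := by
  cases g with
  | prepZ q => exact signed_prepZ_mul s q p hp
  | prepX q => exact signed_prepX_mul s q p hp
  | cnot c t => exact signed_cnot_mul s c t p hp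
  | measZ q k => exact signed_measZ_mul s q k p
  | measX q k => exact signed_measX_mul s q k p
  | corrZ q k => exact signed_corrZ_mul s q k p
  | measPauliZ S k => exact signed_measPauliZ_mul s S k p
  | catState q => exact signed_catState_mul s q p hp
  | catLike q => exact signed_catLike_mul s q p hp

end Gate

/-! ### Moving a fault to the end of a circuit -/

section Frame

variable {W : Type} [DecidableEq W] {m : ℕ}

/-- The Pauli string after the operations `l` equivalent to the string `p` before them and the
fault `F`. -/
def frame : List (Step W m) → (W → Pauli) → Fault W → W → Pauli
  | [], p, F => p + F 0
  | s :: l, p, F => frame l (s.gate.push (p + F 0)) fun t => F (t + 1)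

/-- The operations whose sign parameters are flipped by the string `p` before the operations `l`
and the fault `F`. -/
def flips : List (Step W m) → (W → Pauli) → Fault W → ℕ → ZMod 2
  | [], _, _, _ => 0
  | s :: _, p, F, 0 => s.gate.flip (p + F 0)
  | s :: l, p, F, n + 1 => flips l (s.gate.push (p + F 0)) (fun t => F (t + 1)) n

/-- All operations can be exchanged with the Pauli strings in front of them. -/
def Movable : List (Step W m) → (W → Pauli) → Fault W → Prop
  | [], _, _ => True
  | s :: l, p, F =>
    s.gate.Passes (p + F 0) ∧ Movable l (s.gate.push (p + F 0)) fun t => F (t + 1)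

/-- Propagation is linear modulo phase; this makes the effects of atomic faults add up. -/
theorem frame_add (l : List (Step W m)) (p p' : W → Pauli) (F F' : Fault W) :
    frame l (p + p') (F + F') = frame l p F + frame l p' F' := by
  induction l generalizing p p' F F' with
  | nil => exact add_add_add_comm _ _ _ _
  | cons s l ih =>
    simp only [frame]
    rw [← ih, ← Gate.push_add, Pi.add_apply, add_add_add_comm]
    rfl

theorem flips_add (l : List (Step W m)) (p p' : W → Pauli) (F F' : Fault W) :
    flips l (p + p') (F + F') = flips l p F + flips l p' F' := by
  induction l generalizing p p' F F' with
  | nil => funext n; simp [flips]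
  | cons s l ih =>
    funext n
    cases n with
    | zero => simp only [flips, Pi.add_apply]; rw [← Gate.flip_add, add_add_add_comm]
    | succ n =>
      have h := congrFun (ih (s.gate.push (p + F 0)) (s.gate.push (p' + F' 0))
        (fun t => F (t + 1)) fun t => F' (t + 1)) n
      rw [← Gate.push_add, add_add_add_comm] at h
      exact h

theorem Movable.add {l : List (Step W m)} {p p' : W → Pauli} {F F' : Fault W}
    (h : Movable l p F) (h' : Movable l p' F') : Movable l (p + p') (F + F') := by
  induction l generalizing p p' F F' with
  | nil => trivial
  | cons s l ih =>
    have e : p + p' + (F + F') 0 = (p + F 0) + (p' + F' 0) := add_add_add_comm _ _ _ _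
    refine ⟨e ▸ h.1.add h'.1, ?_⟩
    rw [e, Gate.push_add]
    exact ih h.2 h'.2

variable [Fintype W]

/-- The linear map of a list of operations with given sign parameters. -/
def signedRun : List (Step W m) → (ℕ → ZMod 2) → Matrix (W → ZMod 2) (W → ZMod 2) ℂ
  | [], _ => 1
  | s :: l, σ => signedRun l (fun n => σ (n + 1)) * s.gate.signed (σ 0)

/-- The sign parameters of a list of operations for given outcomes. -/
def settings (o : Fin m → ZMod 2) : List (Step W m) → ℕ → ZMod 2
  | [], _ => 0
  | s :: _, 0 => s.gate.setting o
  | _ :: l, n + 1 => settings o l n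

/-- Induction on the operations with an accumulated incoming string. The shift `n + t` reconciles
the absolute times of `runSteps` with `frame` and `flips`, which restart at `0` for every tail. -/
theorem runSteps_mul_pauliMatrix (l : List (Step W m)) (t : ℕ) (F : Fault W)
    (o : Fin m → ZMod 2) (p : W → Pauli) (h : Movable l p fun n => F (n + t)) :
    UpToSign (runSteps F o t l * pauliMatrix p)
      (pauliMatrix (frame l p fun n => F (n + t)) *
        signedRun l (settings o l + flips l p fun n => F (n + t))) := by
  induction l generalizing t p with
  | nil =>
    simp only [runSteps, frame, signedRun, mul_one, zero_add]
    rw [add_comm]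
    exact pauliMatrix_mul _ _
  | cons s l ih =>
    simp only [runSteps, frame, signedRun]
    obtain ⟨h1, h2⟩ := h
    rw [Matrix.mul_assoc, Matrix.mul_assoc, Gate.toMatrix_eq_signed]
    simp only [zero_add] at h1 h2 ⊢
    have e : (fun n => F (n + 1 + t)) = fun n => F (n + (t + 1)) := by
      funext n; rw [add_assoc, add_comm 1]
    rw [e] at h2 ⊢
    refine (((pauliMatrix_mul _ _).mul_left _).mul_left _).trans ?_
    rw [add_comm (F t) p]
    refine ((Gate.signed_mul_pauliMatrix _ _ _ h1).mul_left _).trans ?_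
    rw [← Matrix.mul_assoc]
    refine ((ih (t + 1) _ h2).mul_right _).trans (UpToSign.of_eq ?_)
    rw [Matrix.mul_assoc]
    have e' : (fun n => (settings o (s :: l) + flips (s :: l) p fun n => F (n + t)) (n + 1))
        = settings o l + flips l (s.gate.push (p + F t)) fun n => F (n + (t + 1)) := by
      funext n
      simp only [Pi.add_apply, settings, flips, zero_add, e]
    rw [e']
    simp only [Pi.add_apply, settings, flips, zero_add]

end Frame

namespace Circuit

variable {d a m r : ℕ}

/-- The fault can be moved to the end of the circuit and ends up on the data qubits only. -/
def Movable (C : Circuit d a m r) (F : Fault (Fin d ⊕ Fin a)) : Prop :=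
  FaultEq.Movable C.steps 0 F ∧ ∀ j, frame C.steps 0 F (Sum.inr j) = 0

/-- The Pauli string on the data outputs to which the fault is moved. -/
def dataFrame (C : Circuit d a m r) (F : Fault (Fin d ⊕ Fin a)) : Fin d → Pauli :=
  fun i => frame C.steps 0 F (Sum.inl i)

/-- The linear map on the data qubits for given sign parameters. -/
def signedKraus (C : Circuit d a m r) (σ : ℕ → ZMod 2) :
    Matrix (Fin d → ZMod 2) (Fin d → ZMod 2) ℂ :=
  Matrix.of fun y x => signedRun C.steps σ (Sum.elim y 0) (Sum.elim x 0)

/-- Restriction to auxiliary values `0` is compatible with the final Pauli because that Pauli is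
trivial on all auxiliary wires. -/
theorem kraus_upToSign (C : Circuit d a m r) (F : Fault (Fin d ⊕ Fin a)) (o : Fin m → ZMod 2)
    (h : C.Movable F) :
    UpToSign (C.kraus F o)
      (pauliMatrix (C.dataFrame F) * C.signedKraus (settings o C.steps + flips C.steps 0 F)) := by
  obtain ⟨u, hu⟩ := runSteps_mul_pauliMatrix C.steps 0 F o 0 h.1
  rw [pauliMatrix_zero, mul_one] at hu
  refine ⟨u, ?_⟩
  ext y x
  have hF : (fun n => F (n + 0)) = F := rfl
  rw [hF] at hu
  rw [Matrix.smul_apply, pauliMatrix_mul_apply, kraus, Matrix.of_apply, hu, Matrix.smul_apply,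
    pauliMatrix_mul_apply, signedKraus, Matrix.of_apply]
  have e : (Sum.elim y 0 : Fin d ⊕ Fin a → ZMod 2) + xPart (frame C.steps 0 F)
      = Sum.elim (y + xPart (C.dataFrame F)) 0 := by
    funext w
    cases w with
    | inl i => rfl
    | inr j => simp [xPart, h.2 j]
  rw [e, Fintype.sum_sum_type]
  simp only [Sum.elim_inl, Sum.elim_inr, Pi.zero_apply, mul_zero, Finset.sum_const_zero, add_zero]
  rfl

end Circuit

/-! ### Faults as lists of atomic faults -/

namespace Circuit

variable {d a m r : ℕ}

/-- Inverses therefore add nothing to the group generated by the atoms: all its elements are plain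
products. -/
theorem fault_neg {W : Type} (F : Fault W) : -F = F := by
  funext t w
  exact Prod.ext (CharTwo.neg_eq _) (CharTwo.neg_eq _)

theorem exists_list_of_mem_faults {C : Circuit d a m r} {F : Fault (Fin d ⊕ Fin a)}
    (hF : F ∈ C.faults) : ∃ l : List (Fault (Fin d ⊕ Fin a)), (∀ A ∈ l, C.Noise A) ∧ l.sum = F := by
  induction hF using AddSubgroup.closure_induction with
  | mem A hA => exact ⟨[A], by simpa using hA, by simp⟩
  | zero => exact ⟨[], by simp, rfl⟩
  | add F F' _ _ h h' =>
    obtain ⟨l, hl, rfl⟩ := h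
    obtain ⟨l', hl', rfl⟩ := h'
    refine ⟨l ++ l', fun A hA => ?_, List.sum_append⟩
    exact (List.mem_append.1 hA).elim (hl A) (hl' A)
  | neg F _ h => rwa [fault_neg]

theorem exists_list_length_eq_wt {C : Circuit d a m r} {F : Fault (Fin d ⊕ Fin a)}
    (hF : F ∈ C.faults) :
    ∃ l : List (Fault (Fin d ⊕ Fin a)), l.length = C.wt F ∧ (∀ A ∈ l, C.Noise A) ∧ l.sum = F := by
  obtain ⟨l, hl, h⟩ := exists_list_of_mem_faults hF
  exact Nat.sInf_mem (s := {n | ∃ l : List (Fault (Fin d ⊕ Fin a)),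
    l.length = n ∧ (∀ A ∈ l, C.Noise A) ∧ l.sum = F}) ⟨l.length, l, rfl, hl, h⟩

theorem wt_sum_le {C : Circuit d a m r} {l : List (Fault (Fin d ⊕ Fin a))}
    (hl : ∀ A ∈ l, C.Noise A) : C.wt l.sum ≤ l.length :=
  Nat.sInf_le ⟨l, rfl, hl, rfl⟩

theorem sum_mem_faults {C : Circuit d a m r} {l : List (Fault (Fin d ⊕ Fin a))}
    (hl : ∀ A ∈ l, C.Noise A) : l.sum ∈ C.faults :=
  AddSubgroup.list_sum_mem _ fun A hA => AddSubgroup.subset_closure (hl A hA)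

/-! ### Normal forms -/

/-- A normal form of a circuit: for any sign parameters of its operations it acts, up to scalars, as
a Pauli string after the map `proj s`, or as zero if the parameters are mismatched. -/
structure NormalForm (C : Circuit d a m r)
    (proj : ZMod 2 → Matrix (Fin d → ZMod 2) (Fin d → ZMod 2) ℂ)
    (base : (Fin r → ZMod 2) → ZMod 2) where
  /-- whether the sign parameters are mismatched -/
  mismatch : (ℕ → ZMod 2) → ZMod 2
  mismatch_add : ∀ σ τ, mismatch (σ + τ) = mismatch σ + mismatch τ
  /-- the Pauli string after the projection -/
  shift : (ℕ → ZMod 2) → Fin d → Pauli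
  shift_add : ∀ σ τ, shift (σ + τ) = shift σ + shift τ
  /-- the sign of the projection -/
  sign : (ℕ → ZMod 2) → ZMod 2
  sign_add : ∀ σ τ, sign (σ + τ) = sign σ + sign τ
  /-- the normalisation -/
  scale : ℝ
  scale_pos : 0 < scale
  signedKraus_of_eq : ∀ σ, mismatch σ = 0 →
    UpToSign (C.signedKraus σ) ((scale : ℂ) • (pauliMatrix (shift σ) * proj (sign σ)))
  signedKraus_of_ne : ∀ σ, mismatch σ ≠ 0 → C.signedKraus σ = 0
  /-- the outcomes whose parity is constrained -/
  check : Finset (Fin m)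
  mismatch_settings : ∀ o, mismatch (settings o C.steps) = ∑ k ∈ check, o k
  satisfies_iff : ∀ o, C.Satisfies o ↔ ∑ k ∈ check, o k = 0
  shift_settings : ∀ o, ∑ k ∈ check, o k = 0 → shift (settings o C.steps) = 0
  sign_settings : ∀ o v, ∑ k ∈ check, o k = 0 → (∀ j, ∑ k ∈ C.readout j, o k = v j) →
    sign (settings o C.steps) = base v
  /-- the number of outcomes for each value of the reported bits -/
  count : ℕ
  count_pos : 0 < count
  card_outcomes : ∀ v : Fin r → ZMod 2, (Finset.univ.filter fun o : Fin m → ZMod 2 =>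
    (∀ j, ∑ k ∈ C.readout j, o k = v j) ∧ ∑ k ∈ check, o k = 0).card = count

/-- The action on density matrices of a Pauli string after a projection. -/
def action (proj : ZMod 2 → Matrix (Fin d → ZMod 2) (Fin d → ZMod 2) ℂ) (e : (Fin d → Pauli) × ZMod 2)
    (s : ZMod 2) (ρ : Matrix (Fin d → ZMod 2) (Fin d → ZMod 2) ℂ) :
    Matrix (Fin d → ZMod 2) (Fin d → ZMod 2) ℂ :=
  pauliMatrix e.1 * proj (s + e.2) * ρ * (pauliMatrix e.1 * proj (s + e.2))ᴴ

theorem _root_.FaultEq.UpToSign.conj_eq {I : Type} [Fintype I] {M N : Matrix I I ℂ} {c : ℝ}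
    (h : UpToSign M ((c : ℂ) • N)) (ρ : Matrix I I ℂ) :
    M * ρ * Mᴴ = ((c ^ 2 : ℝ) : ℂ) • (N * ρ * Nᴴ) := by
  obtain ⟨u, rfl⟩ := h
  simp only [Matrix.conjTranspose_smul, Matrix.smul_mul, Matrix.mul_smul, smul_smul, star_mul', star_sgn,
    Complex.star_def, Complex.conj_ofReal]
  congr 1
  push_cast
  linear_combination (c : ℂ) ^ 2 * sgn_mul_self u

/-! ### Effects and syndromes of faults -/

namespace NormalForm

variable {C : Circuit d a m r} {proj : ZMod 2 → Matrix (Fin d → ZMod 2) (Fin d → ZMod 2) ℂ}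
  {base : (Fin r → ZMod 2) → ZMod 2} (N : NormalForm C proj base)

/-- The effect of a fault on the data qubits. -/
def effect (F : Fault (Fin d ⊕ Fin a)) : (Fin d → Pauli) × ZMod 2 :=
  (C.dataFrame F + N.shift (flips C.steps 0 F), N.sign (flips C.steps 0 F))

/-- Whether a fault is visible in the constrained outcomes. -/
def syndrome (F : Fault (Fin d ⊕ Fin a)) : ZMod 2 := N.mismatch (flips C.steps 0 F)

theorem flips_zero_add (F F' : Fault (Fin d ⊕ Fin a)) :
    flips C.steps 0 (F + F') = flips C.steps 0 F + flips C.steps 0 F' := by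
  rw [← flips_add, add_zero]

theorem frame_zero_add (F F' : Fault (Fin d ⊕ Fin a)) :
    frame C.steps 0 (F + F') = frame C.steps 0 F + frame C.steps 0 F' := by
  rw [← frame_add, add_zero]

theorem effect_add (F F' : Fault (Fin d ⊕ Fin a)) :
    N.effect (F + F') = N.effect F + N.effect F' := by
  refine Prod.ext ?_ ?_
  · simp only [effect, Prod.fst_add, flips_zero_add, N.shift_add]
    rw [add_add_add_comm]
    congr 1
    funext i
    simp only [dataFrame, frame_zero_add, Pi.add_apply]
  · simp only [effect, Prod.snd_add, flips_zero_add, N.sign_add]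

theorem syndrome_add (F F' : Fault (Fin d ⊕ Fin a)) :
    N.syndrome (F + F') = N.syndrome F + N.syndrome F' := by
  rw [syndrome, flips_zero_add, N.mismatch_add]; rfl

theorem effect_zero : N.effect 0 = 0 := by
  have h := N.effect_add 0 0
  rwa [add_zero, left_eq_add] at h

theorem syndrome_zero : N.syndrome 0 = 0 := by
  have h := N.syndrome_add 0 0
  rwa [add_zero, left_eq_add] at h

theorem kraus_of_syndrome_eq {F : Fault (Fin d ⊕ Fin a)} (hF : C.Movable F)
    (hs : N.syndrome F = 0) {o : Fin m → ZMod 2} (ho : ∑ k ∈ N.check, o k = 0)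
    {v : Fin r → ZMod 2} (hv : ∀ j, ∑ k ∈ C.readout j, o k = v j) :
    UpToSign (C.kraus F o) ((N.scale : ℂ) •
      (pauliMatrix (N.effect F).1 * proj (base v + (N.effect F).2))) := by
  refine (C.kraus_upToSign F o hF).trans ?_
  have h0 : N.mismatch (settings o C.steps + flips C.steps 0 F) = 0 := by
    rw [N.mismatch_add, N.mismatch_settings, ho, zero_add]; exact hs
  refine ((N.signedKraus_of_eq _ h0).mul_left _).trans ?_
  rw [N.shift_add, N.shift_settings o ho, zero_add, N.sign_add, N.sign_settings o v ho hv,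
    Matrix.mul_smul, ← Matrix.mul_assoc]
  exact ((pauliMatrix_mul _ _).mul_right _).smul _

theorem kraus_eq_zero {F : Fault (Fin d ⊕ Fin a)} (hF : C.Movable F) {o : Fin m → ZMod 2}
    (ho : ∑ k ∈ N.check, o k + N.syndrome F ≠ 0) : C.kraus F o = 0 := by
  obtain ⟨u, hu⟩ := C.kraus_upToSign F o hF
  rw [hu, N.signedKraus_of_ne, mul_zero, smul_zero]
  rwa [N.mismatch_add, N.mismatch_settings]

/-- All outcomes compatible with `v` and the constraints give the same operator up to sign, and
signs cancel in `M * ρ * Mᴴ`; only the number of outcomes enters. -/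
theorem branch_eq {F : Fault (Fin d ⊕ Fin a)} (hF : C.Movable F) (hs : N.syndrome F = 0)
    (v : Fin r → ZMod 2) (ρ : Matrix (Fin d → ZMod 2) (Fin d → ZMod 2) ℂ) :
    C.branch F v ρ
      = ((N.count * N.scale ^ 2 : ℝ) : ℂ) • action proj (N.effect F) (base v) ρ := by
  classical
  have h : C.branch F v ρ = ∑ o : Fin m → ZMod 2,
      if (∀ j, ∑ k ∈ C.readout j, o k = v j) ∧ ∑ k ∈ N.check, o k = 0 then
        ((N.scale ^ 2 : ℝ) : ℂ) • action proj (N.effect F) (base v) ρ else 0 := by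
    refine Finset.sum_congr rfl fun o _ => ?_
    by_cases hc : (∀ j, ∑ k ∈ C.readout j, o k = v j) ∧ ∑ k ∈ N.check, o k = 0
    · rw [if_pos hc, if_pos ⟨hc.1, (N.satisfies_iff o).2 hc.2⟩]
      exact (N.kraus_of_syndrome_eq hF hs hc.2 hc.1).conj_eq ρ
    · rw [if_neg hc, if_neg fun hh => hc ⟨hh.1, (N.satisfies_iff o).1 hh.2⟩]
  rw [h, ← Finset.sum_filter, Finset.sum_const, N.card_outcomes, ← Nat.cast_smul_eq_nsmul ℂ,
    smul_smul]
  push_cast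
  rfl

/-- Without faults all possible outcomes have parity `0` on `N.check`; a nonzero syndrome leaves
only outcomes of parity `1`. -/
theorem detectable {F : Fault (Fin d ⊕ Fin a)} (h0 : C.Movable 0) (hF : C.Movable F)
    (hs : N.syndrome F ≠ 0) : C.Detectable F := by
  refine ⟨N.check, 0, fun o ho => ?_, fun o ho => ?_⟩
  · by_contra hne
    exact ho (N.kraus_eq_zero h0 (by rwa [N.syndrome_zero, add_zero]))
  · have h01 : ∀ x y : ZMod 2, y ≠ 0 → x + y = 0 → x = 0 + 1 := by decide
    refine h01 _ _ hs ?_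
    by_contra hne
    exact ho (N.kraus_eq_zero hF hne)

theorem total (N : NormalForm C proj base) (h0 : C.Movable 0) : C.Total := by
  intro o ho
  rw [N.satisfies_iff]
  by_contra hne
  exact ho (N.kraus_eq_zero h0 (by rwa [N.syndrome_zero, add_zero]))

end NormalForm

/-! ### Comparing the noise of circuits -/

/-- A normal form with noise analysis: `R` is the set of effects of single undetectable atomic
faults (up to the stabiliser `g`), and two detectable atomic faults have the effect of two
undetectable ones. -/
structure NoiseAnalysis {C : Circuit d a m r}
    {proj : ZMod 2 → Matrix (Fin d → ZMod 2) (Fin d → ZMod 2) ℂ}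
    {base : (Fin r → ZMod 2) → ZMod 2} (N : NormalForm C proj base)
    (g : Fin d → Pauli) (R : (Fin d → Pauli) × ZMod 2 → Prop) : Prop where
  movable_zero : C.Movable 0
  movable : ∀ A, C.Noise A → C.Movable A
  effect_mem : ∀ A, C.Noise A → N.syndrome A = 0 → R (N.effect A)
  effect_pair : ∀ A A', C.Noise A → C.Noise A' → N.syndrome A ≠ 0 → N.syndrome A' ≠ 0 →
    ∃ e e', R e ∧ R e' ∧ N.effect A + N.effect A' = e + e'
  realised : ∀ e, R e → ∃ A, C.Noise A ∧ N.syndrome A = 0 ∧ ∃ c : ZMod 2,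
    N.effect A = e + (c • g, 0)

namespace NoiseAnalysis

variable {C : Circuit d a m r} {proj : ZMod 2 → Matrix (Fin d → ZMod 2) (Fin d → ZMod 2) ℂ}
  {base : (Fin r → ZMod 2) → ZMod 2} {N : NormalForm C proj base}
  {g : Fin d → Pauli} {R : (Fin d → Pauli) × ZMod 2 → Prop}

theorem movable_sum (hN : NoiseAnalysis N g R) (l : List (Fault (Fin d ⊕ Fin a)))
    (hl : ∀ A ∈ l, C.Noise A) : C.Movable l.sum := by
  induction l with
  | nil => exact hN.movable_zero
  | cons A l ih =>
    rw [List.forall_mem_cons] at hl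
    have h1 := hN.movable A hl.1
    have h2 := ih hl.2
    rw [List.sum_cons]
    refine ⟨?_, fun j => ?_⟩
    · have := h1.1.add h2.1
      rwa [add_zero] at this
    · rw [NormalForm.frame_zero_add, Pi.add_apply, h1.2, h2.2, add_zero]

/-- Induction with at most one atom of nonzero syndrome kept pending: the next such atom is paired
with it through `effect_pair`. The bound `es.length + 1` reserves the place of the pending atom. -/
theorem effect_sum (hN : NoiseAnalysis N g R) (l : List (Fault (Fin d ⊕ Fin a)))
    (hl : ∀ A ∈ l, C.Noise A) :
    (N.syndrome l.sum = 0 → ∃ es : List ((Fin d → Pauli) × ZMod 2), (∀ e ∈ es, R e) ∧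
      es.length ≤ l.length ∧ N.effect l.sum = es.sum) ∧
    (N.syndrome l.sum ≠ 0 → ∃ A, C.Noise A ∧ N.syndrome A ≠ 0 ∧
      ∃ es : List ((Fin d → Pauli) × ZMod 2), (∀ e ∈ es, R e) ∧
        es.length + 1 ≤ l.length ∧ N.effect l.sum = N.effect A + es.sum) := by
  have h01 : ∀ x y : ZMod 2, x ≠ 0 → (x + y = 0 ↔ y ≠ 0) := by decide
  induction l with
  | nil =>
    refine ⟨fun _ => ⟨[], by simp, by simp, ?_⟩, fun h => absurd N.syndrome_zero h⟩
    exact N.effect_zero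
  | cons A l ih =>
    rw [List.forall_mem_cons] at hl
    obtain ⟨ih0, ih1⟩ := ih hl.2
    rw [List.sum_cons, N.syndrome_add, N.effect_add, List.length_cons]
    by_cases hA : N.syndrome A = 0
    · rw [hA, zero_add]
      have hR := hN.effect_mem A hl.1 hA
      refine ⟨fun hs => ?_, fun hs => ?_⟩
      · obtain ⟨es, h1, h2, h3⟩ := ih0 hs
        exact ⟨N.effect A :: es, List.forall_mem_cons.2 ⟨hR, h1⟩, by simpa using h2,
          by rw [h3, List.sum_cons]⟩
      · obtain ⟨B, hB, hBs, es, h1, h2, h3⟩ := ih1 hs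
        exact ⟨B, hB, hBs, N.effect A :: es, List.forall_mem_cons.2 ⟨hR, h1⟩,
          by simpa using h2, by rw [h3, List.sum_cons, add_left_comm]⟩
    · rw [ne_eq, h01 _ _ hA, not_not]
      refine ⟨fun hs => ?_, fun hs => ?_⟩
      · obtain ⟨B, hB, hBs, es, h1, h2, h3⟩ := ih1 hs
        obtain ⟨e, e', he, he', hee⟩ := hN.effect_pair A B hl.1 hB hA hBs
        refine ⟨e :: e' :: es, ?_, ?_, ?_⟩
        · simp only [List.forall_mem_cons]
          exact ⟨he, he', h1⟩
        · simp only [List.length_cons]; omega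
        · rw [h3, ← add_assoc, hee, List.sum_cons, List.sum_cons, add_assoc]
      · obtain ⟨es, h1, h2, h3⟩ := ih0 hs
        exact ⟨A, hl.1, hA, es, h1, by omega, by rw [h3]⟩

theorem exists_noise (hN : NoiseAnalysis N g R) (es : List ((Fin d → Pauli) × ZMod 2))
    (hes : ∀ e ∈ es, R e) : ∃ l : List (Fault (Fin d ⊕ Fin a)), (∀ A ∈ l, C.Noise A) ∧
      l.length = es.length ∧ N.syndrome l.sum = 0 ∧
      ∃ c : ZMod 2, N.effect l.sum = es.sum + (c • g, 0) := by
  induction es with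
  | nil =>
    refine ⟨[], by simp, rfl, N.syndrome_zero, 0, ?_⟩
    rw [zero_smul, List.sum_nil, List.sum_nil, N.effect_zero]
    rfl
  | cons e es ih =>
    rw [List.forall_mem_cons] at hes
    obtain ⟨l, h1, h2, h3, c, h4⟩ := ih hes.2
    obtain ⟨A, hA, hs, c', he⟩ := hN.realised e hes.1
    refine ⟨A :: l, List.forall_mem_cons.2 ⟨hA, h1⟩, by simp [h2], ?_, c' + c, ?_⟩
    · rw [List.sum_cons, N.syndrome_add, hs, h3, add_zero]
    · rw [List.sum_cons, N.effect_add, he, h4, List.sum_cons, add_add_add_comm, add_smul]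
      congr 1

variable {a' m' : ℕ} {C' : Circuit d a' m' r} {N' : NormalForm C' proj base}

/-- The fault is split into atoms, their effects are rewritten in `R`, and each member of `R` is
realised by one atom of `C'`, so the weight cannot grow; the powers of `g` so acquired are absorbed
by the projection. -/
theorem faultsCovered (hN : NoiseAnalysis N g R) (hN' : NoiseAnalysis N' g R)
    (hg : ∀ s, UpToSign (pauliMatrix g * proj s) (proj s)) (w : ℕ) :
    FaultsCovered w C C' := by
  intro F hF _
  obtain ⟨l, hlen, hl, rfl⟩ := exists_list_length_eq_wt hF
  have hmov := hN.movable_sum l hl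
  by_cases hs : N.syndrome l.sum = 0
  swap
  · exact Or.inl (N.detectable hN.movable_zero hmov hs)
  right
  obtain ⟨es, h1, h2, h3⟩ := (hN.effect_sum l hl).1 hs
  obtain ⟨l', h1', h2', h3', c, h4'⟩ := hN'.exists_noise es h1
  refine ⟨l'.sum, sum_mem_faults h1', ?_, ?_⟩
  · rw [← hlen]
    exact (wt_sum_le h1').trans (h2'.le.trans h2)
  · have p1 : 0 < N.count * N.scale ^ 2 :=
      mul_pos (Nat.cast_pos.2 N.count_pos) (pow_pos N.scale_pos 2)
    have p2 : 0 < N'.count * N'.scale ^ 2 :=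
      mul_pos (Nat.cast_pos.2 N'.count_pos) (pow_pos N'.scale_pos 2)
    -- Both branches are the same action, weighted by the number of outcomes times the squared
    -- normalisation; the common scalar is the ratio, independent of `v` and `ρ`.
    refine ⟨(N.count * N.scale ^ 2) / (N'.count * N'.scale ^ 2), div_pos p1 p2, fun v ρ => ?_⟩
    rw [N.branch_eq hmov hs, N'.branch_eq (hN'.movable_sum l' h1') h3', smul_smul,
      ← Complex.ofReal_mul, div_mul_cancel₀ _ p2.ne', h4', h3]
    refine congrArg _ ?_
    have key : ∀ s, UpToSign (pauliMatrix (es.sum.1 + c • g) * proj s)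
        (((1 : ℝ) : ℂ) • (pauliMatrix es.sum.1 * proj s)) := by
      intro s
      rw [Complex.ofReal_one, one_smul]
      refine ((pauliMatrix_mul _ _).symm.mul_right _).trans ?_
      rw [Matrix.mul_assoc]
      refine UpToSign.mul_left _ ?_
      have h01 : ∀ c : ZMod 2, c = 0 ∨ c = 1 := by decide
      rcases h01 c with rfl | rfl
      · rw [zero_smul, pauliMatrix_zero, one_mul]
        exact UpToSign.of_eq rfl
      · rw [one_smul]
        exact hg s
    have := (key (base v + es.sum.2)).conj_eq ρ
    rw [one_pow, Complex.ofReal_one, one_smul] at this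
    rw [action, action, Prod.fst_add, Prod.snd_add, add_zero, this]

theorem faultEquivalent (hN : NoiseAnalysis N g R) (hN' : NoiseAnalysis N' g R)
    (hg : ∀ s, UpToSign (pauliMatrix g * proj s) (proj s)) : C.FaultEquivalent C' :=
  fun w => ⟨hN.faultsCovered hN' hg w, hN'.faultsCovered hN hg w⟩

end NoiseAnalysis
end Circuit

/-! ### Runs on computational basis states -/

section Runs

variable {W : Type} [Fintype W] [DecidableEq W] {m : ℕ}

theorem sum_zmod_two {M : Type} [AddCommMonoid M] (f : ZMod 2 → M) : ∑ v, f v = f 0 + f 1 :=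
  Fin.sum_univ_two f

theorem signedRun_nil (σ : ℕ → ZMod 2) (b a : W → ZMod 2) :
    signedRun ([] : List (Step W m)) σ b a = if b = a then 1 else 0 :=
  Matrix.one_apply

theorem signedRun_cons (s : Step W m) (l : List (Step W m)) (σ : ℕ → ZMod 2) (b a : W → ZMod 2) :
    signedRun (s :: l) σ b a
      = ∑ c, signedRun l (fun n => σ (n + 1)) b c * s.gate.signed (σ 0) c a :=
  Matrix.mul_apply

variable (e : Level) (l : List (Step W m)) (σ : ℕ → ZMod 2) (b a : W → ZMod 2)

theorem signedRun_prepZ (q : W) :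
    signedRun (⟨.prepZ q, e⟩ :: l) σ b a
      = if a q = 0 then signedRun l (fun n => σ (n + 1)) b a else 0 := by
  simp [signedRun_cons, Gate.signed, Gate.toMatrix, ite_and]

theorem signedRun_prepX (q : W) :
    signedRun (⟨.prepX q, e⟩ :: l) σ b a
      = if a q = 0 then ∑ v, ketX 0 v *
        signedRun l (fun n => σ (n + 1)) b (Function.update a q v) else 0 := by
  simp only [signedRun_cons, Gate.signed, Gate.toMatrix, Matrix.of_apply, ite_and, mul_ite, mul_zero]
  by_cases ha : a q = 0
  swap
  · simp [ha]
  simp only [ha, if_true]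
  rw [← Finset.sum_filter]
  refine Finset.sum_bij' (fun c _ => c q) (fun v _ => Function.update a q v) (by simp) ?_ ?_ ?_ ?_
  · intro v _
    simp [← ha]
  · intro c hc
    rw [Finset.mem_filter] at hc
    rw [← hc.2]
    simp
  · simp
  · intro c hc
    rw [Finset.mem_filter] at hc
    rw [← hc.2]
    simp [mul_comm]

theorem signedRun_cnot (c t : W) :
    signedRun (⟨.cnot c t, e⟩ :: l) σ b a
      = signedRun l (fun n => σ (n + 1)) b (Function.update a t (a t + a c)) := by
  simp [signedRun_cons, Gate.signed, Gate.toMatrix]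

theorem signedRun_measZ (q : W) (k : Fin m) :
    signedRun (⟨.measZ q k, e⟩ :: l) σ b a
      = if a q = σ 0 then signedRun l (fun n => σ (n + 1)) b (Function.update a q 0) else 0 := by
  simp [signedRun_cons, Gate.signed, Gate.toMatrix, ite_and]

theorem signedRun_measX (q : W) (k : Fin m) :
    signedRun (⟨.measX q k, e⟩ :: l) σ b a
      = ketX (σ 0) (a q) * signedRun l (fun n => σ (n + 1)) b (Function.update a q 0) := by
  simp [signedRun_cons, Gate.signed, Gate.toMatrix, mul_comm]

theorem signedRun_corrZ (q : W) (k : Fin m) :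
    signedRun (⟨.corrZ q k, e⟩ :: l) σ b a
      = sgn (σ 0 * a q) * signedRun l (fun n => σ (n + 1)) b a := by
  simp [signedRun_cons, Gate.signed, Gate.toMatrix, mul_comm]

theorem signedRun_measPauliZ (S : Finset W) (k : Fin m) :
    signedRun (⟨.measPauliZ S k, e⟩ :: l) σ b a
      = if ∑ q ∈ S, a q = σ 0 then signedRun l (fun n => σ (n + 1)) b a else 0 := by
  have h : ∀ x y : ZMod 2, (1 + sgn x * sgn y) / 2 = if y = x then 1 else 0 := by
    intro x y
    rw [← sgn_add, sgn]
    simp only [CharTwo.add_eq_zero, eq_comm (a := x)]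
    split_ifs <;> norm_num
  simp [signedRun_cons, Gate.signed, Gate.toMatrix, h]

/-- The output states with nonzero amplitude are parametrised by the common flip `v` of the two
bits. -/
theorem signedRun_catLike (q : Fin 2 → W) (hq : q 0 ≠ q 1) :
    signedRun (⟨.catLike q, e⟩ :: l) σ b a
      = ∑ v, sgn (σ 0 * v) / 2 * signedRun l (fun n => σ (n + 1)) b
        (Function.update (Function.update a (q 0) (a (q 0) + v)) (q 1) (a (q 1) + v)) := by
  simp only [signedRun_cons, Gate.signed, Gate.toMatrix, Matrix.of_apply, xSpider_two_two,
    ← ite_and, mul_ite, mul_zero]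
  rw [← Finset.sum_filter]
  have key : ∀ c ∈ Finset.univ.filter (fun c : W → ZMod 2 =>
      (∀ w, (∀ i, w ≠ q i) → c w = a w) ∧ a (q 0) + c (q 0) = a (q 1) + c (q 1)),
      Function.update (Function.update a (q 0) (a (q 0) + (a (q 0) + c (q 0)))) (q 1)
        (a (q 1) + (a (q 0) + c (q 0))) = c := by
    intro c hc
    rw [Finset.mem_filter] at hc
    funext w
    by_cases h1 : w = q 1
    · rw [h1, Function.update_self, hc.2.2, ← add_assoc, CharTwo.add_self_eq_zero, zero_add]
    · rw [Function.update_of_ne h1]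
      by_cases h0 : w = q 0
      · rw [h0, Function.update_self, ← add_assoc, CharTwo.add_self_eq_zero, zero_add]
      · rw [Function.update_of_ne h0, hc.2.1 w (fun i => by fin_cases i; exacts [h0, h1])]
  refine Finset.sum_bij' (fun c _ => a (q 0) + c (q 0))
    (fun v _ => Function.update (Function.update a (q 0) (a (q 0) + v)) (q 1) (a (q 1) + v))
    (by simp) ?_ key ?_ ?_
  · intro v _
    rw [Finset.mem_filter]
    refine ⟨Finset.mem_univ _, fun w hw => ?_, ?_⟩
    · rw [Function.update_of_ne (hw 1), Function.update_of_ne (hw 0)]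
    · rw [Function.update_self, Function.update_of_ne hq, Function.update_self, ← add_assoc,
        ← add_assoc, CharTwo.add_self_eq_zero, CharTwo.add_self_eq_zero]
  · intro v _
    rw [Function.update_of_ne hq, Function.update_self, ← add_assoc, CharTwo.add_self_eq_zero,
      zero_add]
  · intro c hc
    rw [key c hc]
    ring

end Runs

/-! ### Evaluation of the six circuits for arbitrary sign parameters -/

section Concrete

variable {m : ℕ}

/-- The projector onto the eigenvalue `(-1)^s` of `ZZZZ`. -/
def zProj (s : ZMod 2) : Matrix (Fin 4 → ZMod 2) (Fin 4 → ZMod 2) ℂ :=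
  Matrix.of fun y x => if y = x ∧ x 0 + x 1 + x 2 + x 3 = s then 1 else 0

theorem update_two_zero (x y v : ZMod 2) : Function.update ![x, y] 0 v = ![v, y] := by
  ext i; fin_cases i <;> rfl

theorem update_two_one (x y v : ZMod 2) : Function.update ![x, y] 1 v = ![x, v] := by
  ext i; fin_cases i <;> rfl

theorem update_three_zero (x y z v : ZMod 2) : Function.update ![x, y, z] 0 v = ![v, y, z] := by
  ext i; fin_cases i <;> rfl

theorem update_three_one (x y z v : ZMod 2) : Function.update ![x, y, z] 1 v = ![x, v, z] := by
  ext i; fin_cases i <;> rfl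

theorem update_three_two (x y z v : ZMod 2) : Function.update ![x, y, z] 2 v = ![x, y, v] := by
  ext i; fin_cases i <;> rfl

theorem zero_two : (0 : Fin 2 → ZMod 2) = ![0, 0] := by ext i; fin_cases i <;> rfl

theorem zero_three : (0 : Fin 3 → ZMod 2) = ![0, 0, 0] := by ext i; fin_cases i <;> rfl

theorem zero_four : (0 : Fin 4 → ZMod 2) = ![0, 0, 0, 0] := by ext i; fin_cases i <;> rfl

theorem zero_one : (0 : Fin 1 → ZMod 2) = ![0] := by ext i; fin_cases i; rfl

theorem update_one_zero (x v : ZMod 2) : Function.update ![x] 0 v = ![v] := by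
  ext i; fin_cases i; rfl

theorem update_four_zero (x y z t v : ZMod 2) :
    Function.update ![x, y, z, t] 0 v = ![v, y, z, t] := by
  ext i; fin_cases i <;> rfl

theorem update_four_one (x y z t v : ZMod 2) :
    Function.update ![x, y, z, t] 1 v = ![x, v, z, t] := by
  ext i; fin_cases i <;> rfl

theorem update_four_two (x y z t v : ZMod 2) :
    Function.update ![x, y, z, t] 2 v = ![x, y, v, t] := by
  ext i; fin_cases i <;> rfl

theorem update_four_three (x y z t v : ZMod 2) :
    Function.update ![x, y, z, t] 3 v = ![x, y, z, v] := by
  ext i; fin_cases i <;> rfl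

/-- Two consecutive `XX` measurements with outcomes `s` and `t`: the bits `v` and `w` tell whether
each applies `XX`, and the product of the two projections vanishes unless `s = t`. -/
theorem sum_ketX_sum_ketX (s t : ZMod 2) (k : ℂ) (f : ZMod 2 → ℂ) :
    ∑ v, ketX 0 v * (ketX s v * (k * ∑ w, ketX 0 w * (ketX t w * f (v + w))))
      = if s = t then k * ∑ v, sgn (t * v) / 2 * f v else 0 := by
  have h : ∀ (s v : ZMod 2) (c : ℂ), ketX 0 v * (ketX s v * c) = sgn (s * v) / 2 * c := by
    intro s v c
    have h2 : ((Real.sqrt 2 : ℝ) : ℂ) * (Real.sqrt 2 : ℝ) = 2 := by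
      rw [← Complex.ofReal_mul, Real.mul_self_sqrt (by norm_num)]
      norm_num
    rw [← mul_assoc, ketX, ketX, div_mul_div_comm, h2, zero_mul, sgn_zero, one_mul]
  have h11 : (1 : ZMod 2) + 1 = 0 := rfl
  simp only [h, sum_zmod_two, mul_zero, mul_one, sgn_zero, add_zero, zero_add, h11]
  split_ifs with hst
  · subst hst
    linear_combination (k * f 0 / 4) * sgn_mul_self s
  · have h1 : t = s + 1 := by
      revert s t; decide
    have hs1 : sgn (1 : ZMod 2) = -1 := if_neg (by decide)
    rw [h1, sgn_add, hs1]
    linear_combination (-k * f 0 / 4) * sgn_mul_self s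

theorem pauliMatrix_z_mul_apply {n : ℕ} (z : Fin n → ZMod 2)
    (M : Matrix (Fin n → ZMod 2) (Fin n → ZMod 2) ℂ) (y x : Fin n → ZMod 2) :
    (pauliMatrix (fun i => (0, z i)) * M) y x = sgn (∑ i, z i * y i) * M y x := by
  rw [pauliMatrix_mul_apply]
  have : y + xPart (fun i => ((0, z i) : Pauli)) = y := by
    funext i; simp [xPart]
  rw [this]
  rfl

theorem add_add_eq_iff : ∀ a b c d : ZMod 2, a + b + c = d ↔ b = a + c + d := by decide

theorem signedKraus_zzzz (σ : ℕ → ZMod 2) : zzzzMeasurement.signedKraus σ = zProj (σ 0) := by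
  ext y x
  simp only [Circuit.signedKraus, zzzzMeasurement, signedRun_measPauliZ, signedRun_nil, zProj,
    Matrix.of_apply, Sum.elim_eq_iff, and_true]
  rw [Finset.sum_image (fun i _ j _ h => Sum.inl_injective h), Fin.sum_univ_four]
  simp only [Sum.elim_inl, and_comm (a := y = x), ite_and]
  rfl

/-- A flipped cat-like map (`σ 4 = 1`) equals the ordinary one between `Z`s on `aux 0`. The earlier
`Z` moves back to data 0, the later one forward to data 2. -/
theorem signedKraus_optimised (σ : ℕ → ZMod 2) :
    UpToSign (optimisedCircuit.signedKraus σ) ((1 / 2 : ℂ) •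
      (pauliMatrix (fun i => (0, ![σ 4, 0, σ 4, 0] i)) * zProj (σ 7 + σ 8))) := by
  -- Measuring `aux 0` fixes the common flip to `x 0 + x 2 + σ 7`; this is the part of its sign that
  -- does not depend on `x`.
  refine ⟨σ 4 * σ 7, ?_⟩
  ext y x
  simp only [Circuit.signedKraus, optimisedCircuit, Matrix.of_apply, signedRun_prepZ,
    signedRun_cnot, zero_two]
  simp only [aux, dat, Sum.elim_inr, Sum.elim_inl, Matrix.cons_val_zero, Matrix.cons_val_one,
    Sum.update_elim_inr, update_two_zero, update_two_one, zero_add, if_true]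
  rw [signedRun_catLike _ _ _ _ _ _ (by simp)]
  simp only [signedRun_cnot, signedRun_measZ, signedRun_nil, Sum.elim_eq_iff, Sum.elim_inr,
    Sum.elim_inl, Matrix.cons_val_zero, Matrix.cons_val_one, Sum.update_elim_inr, update_two_zero,
    update_two_one, zero_add, Nat.reduceAdd, and_true]
  simp only [Matrix.smul_apply, pauliMatrix_z_mul_apply, zProj, Matrix.of_apply,
    add_add_eq_iff (x 0), mul_ite, mul_one, mul_zero, Finset.sum_ite_eq', Finset.mem_univ, if_true,
    Fin.sum_univ_four, Matrix.cons_val, smul_eq_mul, zero_mul, add_zero]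
  have h : ∀ a b c d e f : ZMod 2, b + (a + c + e) + d = f ↔ a + b + c + d = e + f := by decide
  simp only [h, ite_and]
  split_ifs with h1 h2
  · rw [← h2, mul_left_comm, ← sgn_add, div_eq_mul_one_div, mul_comm (1 / 2 : ℂ)]
    congr 2
    ring
  all_goals rfl

theorem signedKraus_complete_apply (σ : ℕ → ZMod 2) (y x : Fin 4 → ZMod 2) :
    completeCircuit.signedKraus σ y x = if σ 7 = σ 12 then
      sgn (σ 8 * x 0) * (sgn (σ 12 * (x 0 + x 2 + σ 16)) / 2 * sgn (σ 13 * (x 2 + σ 16)) *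
        zProj (σ 16 + σ 17) y x) else 0 := by
  simp only [Circuit.signedKraus, completeCircuit, xxMeasurement, List.cons_append,
    List.nil_append, Matrix.of_apply, signedRun_prepZ, signedRun_prepX, signedRun_measX,
    signedRun_corrZ, signedRun_cnot, signedRun_measZ, signedRun_nil, zero_three]
  simp only [Sum.elim_inr, Sum.elim_inl, Sum.update_elim_inr, Matrix.cons_val_zero,
    Matrix.cons_val_one, Matrix.cons_val, update_three_zero, update_three_one, update_three_two,
    if_true, zero_add, Nat.reduceAdd, Sum.elim_eq_iff, and_true]
  -- Reassociation makes the two ancilla bits occur only as `v + w`, as the double-measurement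
  -- formula requires.
  simp only [add_assoc (x 0) _ _, add_assoc (x 1) _ _]
  rw [sum_ketX_sum_ketX _ _ _ fun v => sgn (σ 13 * (x 0 + v)) * if x 0 + (v + x 2) = σ 16 then
    if x 1 + (v + x 3) = σ 17 then if y = x then 1 else 0 else 0 else 0]
  have h : ∀ a b c d : ZMod 2, a + (b + c) = d ↔ b = a + c + d := by decide
  have h1 : ∀ a b c d e f : ZMod 2, b + (a + c + e + d) = f ↔ a + b + c + d = e + f := by
    decide
  have h2 : ∀ a b c : ZMod 2, a + (a + b + c) = b + c := by decide
  simp only [h (x 0), mul_ite, mul_zero, Finset.sum_ite_eq', Finset.mem_univ, if_true,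
    zProj, Matrix.of_apply, h1, h2, ite_and, mul_one]
  split_ifs
  · rw [add_assoc (x 0)]
  all_goals rfl

theorem signedKraus_complete_of_ne (σ : ℕ → ZMod 2) (h : σ 7 ≠ σ 12) :
    completeCircuit.signedKraus σ = 0 := by
  ext y x
  rw [signedKraus_complete_apply, if_neg h]
  rfl

theorem signedKraus_complete (σ : ℕ → ZMod 2) (h : σ 7 = σ 12) :
    UpToSign (completeCircuit.signedKraus σ) ((1 / 2 : ℂ) •
      (pauliMatrix (fun i => (0, ![σ 8 + σ 12, 0, σ 13 + σ 12, 0] i)) * zProj (σ 16 + σ 17))) := by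
  -- The terms of the total sign that do not depend on `x`; the others form the Pauli string on data
  -- 0 and 2.
  refine ⟨(σ 12 + σ 13) * σ 16, ?_⟩
  ext y x
  rw [signedKraus_complete_apply, if_pos h]
  simp only [Matrix.smul_apply, pauliMatrix_z_mul_apply, zProj, Matrix.of_apply,
    Fin.sum_univ_four, Matrix.cons_val, smul_eq_mul, zero_mul, add_zero]
  split_ifs with hc
  · rw [hc.1]
    have e : ∀ a b c d f g : ZMod 2, sgn (c * a) * (sgn (d * (a + b + g)) * sgn (f * (b + g)))
        = sgn ((d + f) * g) * sgn ((c + d) * a + (f + d) * b) := by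
      intro a b c d f g
      simp only [← sgn_add]
      congr 1
      ring
    linear_combination (1 / 2) * e (x 0) (x 2) (σ 8) (σ 12) (σ 13) (σ 16)
  · simp only [mul_zero]

/-- The projector onto the eigenvalue `(-1)^s` of `XX`. -/
def xProj (s : ZMod 2) : Matrix (Fin 2 → ZMod 2) (Fin 2 → ZMod 2) ℂ :=
  Matrix.of fun y x => ∑ v, if y = ![x 0 + v, x 1 + v] then sgn (s * v) / 2 else 0

theorem signedKraus_catLike (σ : ℕ → ZMod 2) : catLikeCircuit.signedKraus σ = xProj (σ 0) := by
  ext y x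
  obtain ⟨x0, x1, rfl⟩ : ∃ a b, x = ![a, b] := ⟨x 0, x 1, by ext i; fin_cases i <;> rfl⟩
  simp only [Circuit.signedKraus, catLikeCircuit, Matrix.of_apply]
  rw [signedRun_catLike _ _ _ _ _ _ (by simp)]
  simp only [signedRun_nil, dat, Matrix.cons_val_zero, Matrix.cons_val_one, Sum.elim_inl,
    Sum.update_elim_inl, update_two_zero, update_two_one, Sum.elim_eq_iff, and_true, xProj,
    Matrix.of_apply, mul_ite, mul_one, mul_zero]
  rfl

theorem signedKraus_impl_apply (σ : ℕ → ZMod 2) (y x : Fin 2 → ZMod 2) :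
    catLikeImplementation.signedKraus σ y x = if σ 4 = σ 8 then
      sgn (σ 0 * x 0) * ∑ v, sgn (σ 8 * v) / 2 * (sgn (σ 9 * (x 0 + v)) *
        if y = ![x 0 + v, x 1 + v] then 1 else 0) else 0 := by
  obtain ⟨x0, x1, rfl⟩ : ∃ a b, x = ![a, b] := ⟨x 0, x 1, by ext i; fin_cases i <;> rfl⟩
  simp only [Circuit.signedKraus, catLikeImplementation, xxMeasurement, List.cons_append,
    List.nil_append, Matrix.of_apply, signedRun_prepX, signedRun_measX, signedRun_corrZ,
    signedRun_cnot, signedRun_nil, zero_one]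
  simp only [Sum.elim_inr, Sum.elim_inl, Sum.update_elim_inr, Sum.update_elim_inl,
    Matrix.cons_val_zero, Matrix.cons_val_one, update_two_zero, update_two_one,
    update_one_zero, if_true, zero_add, Nat.reduceAdd, Sum.elim_eq_iff, and_true]
  simp only [add_assoc]
  have h := sum_ketX_sum_ketX (σ 4) (σ 8) 1 fun v => sgn (σ 9 * (x0 + v)) *
    if y = ![x0 + v, x1 + v] then 1 else 0
  simp only [one_mul] at h
  rw [h, mul_ite, mul_zero]
  rfl

theorem signedKraus_impl_of_ne (σ : ℕ → ZMod 2) (h : σ 4 ≠ σ 8) :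
    catLikeImplementation.signedKraus σ = 0 := by
  ext y x
  rw [signedKraus_impl_apply, if_neg h]
  rfl

/-- Moving the first correction `Z^(σ 0)` behind the projection flips the eigenvalue by `σ 0`,
whence the argument `σ 0 + σ 8`. -/
theorem signedKraus_impl (σ : ℕ → ZMod 2) (h : σ 4 = σ 8) :
    catLikeImplementation.signedKraus σ
      = pauliMatrix (fun i => (0, ![σ 0 + σ 9, 0] i)) * xProj (σ 0 + σ 8) := by
  ext y x
  rw [signedKraus_impl_apply, if_pos h]
  simp only [pauliMatrix_z_mul_apply, xProj, Matrix.of_apply, Fin.sum_univ_two,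
    Matrix.cons_val_zero, Matrix.cons_val_one, zero_mul, add_zero]
  rw [Finset.mul_sum, Finset.mul_sum]
  refine Finset.sum_congr rfl fun v _ => ?_
  by_cases hc : y = ![x 0 + v, x 1 + v]
  · rw [if_pos hc, if_pos hc, hc, Matrix.cons_val_zero]
    have e : ∀ a b c d v : ZMod 2, sgn (a * b) * (sgn (c * v) * sgn (d * (b + v)))
        = sgn ((a + d) * (b + v)) * sgn ((a + c) * v) := by
      intro a b c d v
      simp only [← sgn_add]
      congr 1
      revert a b c d v
      decide
    linear_combination (1 / 2) * e (σ 0) (x 0) (σ 8) (σ 9) v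
  · rw [if_neg hc, if_neg hc]
    simp only [mul_zero]

theorem signedRun_catState_aux {n d : ℕ} (e : Level) (l : List (Step (Fin d ⊕ Fin 4) n))
    (σ : ℕ → ZMod 2) (b : Fin d ⊕ Fin 4 → ZMod 2) (x : Fin d → ZMod 2) :
    signedRun (⟨.catState ![aux 0, aux 1, aux 2, aux 3], e⟩ :: l) σ b (Sum.elim x ![0, 0, 0, 0])
      = ∑ z : Fin 4 → ZMod 2, (if z 0 + z 1 + z 2 + z 3 = 0 then 1 / 2 else 0) * signedRun l (fun n => σ (n + 1)) b
        (Sum.elim x ![z 0, z 1, z 2, z 3]) := by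
  have hz : ∀ z : Fin 4 → ZMod 2, ![z 0, z 1, z 2, z 3] = z := by
    intro z; ext i; fin_cases i <;> rfl
  have hq : ∀ i, (![aux 0, aux 1, aux 2, aux 3] : Fin 4 → Fin d ⊕ Fin 4) i = aux i := by
    intro i; fin_cases i <;> rfl
  simp only [signedRun_cons, Gate.signed, Gate.toMatrix, Matrix.of_apply, xSpider_zero_four, hz, hq,
    mul_ite, mul_zero, ← zero_four]
  rw [← Finset.sum_filter]
  symm
  simp only [ite_mul, zero_mul]
  refine Finset.sum_bij' (fun z _ => Sum.elim x z) (fun c _ j => c (aux j)) ?_ (by simp) ?_ ?_ ?_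
  · intro z _
    simp only [Finset.mem_filter, Finset.mem_univ, true_and, aux, Sum.elim_inr, Pi.zero_apply,
      implies_true]
    rintro (i | j) hw
    · rfl
    · exact absurd rfl (hw j)
  · intro z _; rfl
  · intro c hc
    rw [Finset.mem_filter] at hc
    funext w
    rcases w with i | j
    · exact (hc.2.2 (Sum.inl i) (by simp)).symm
    · rfl
  · intro z _
    simp [mul_comm]

/-- The outcomes determine the cat-state bits as `x i + σ (i + 5)`, and the even parity of the cat
state turns into the parity condition on `x`. -/
theorem signedKraus_shor (σ : ℕ → ZMod 2) :
    shorCircuit.signedKraus σ = (1 / 2 : ℂ) • zProj (σ 5 + σ 6 + σ 7 + σ 8) := by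
  ext y x
  simp only [Circuit.signedKraus, shorCircuit, Matrix.of_apply, signedRun_catState_aux, zero_four]
  simp only [signedRun_cnot, signedRun_measZ, signedRun_nil]
  simp only [Sum.elim_inr, Sum.elim_inl, Sum.update_elim_inr, Matrix.cons_val_zero,
    Matrix.cons_val_one, Matrix.cons_val, update_four_zero, update_four_one, update_four_two,
    update_four_three, Nat.reduceAdd, Sum.elim_eq_iff, and_true]
  have h : ∀ (z : Fin 4 → ZMod 2) (i : Fin 4) (k : ℕ), z i + x i = σ k ↔ z i = x i + σ k := by
    have h : ∀ a b c : ZMod 2, a + b = c ↔ a = b + c := by decide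
    exact fun z i k => h _ _ _
  simp only [h]
  have hz : ∀ (z : Fin 4 → ZMod 2) (p q r s : ZMod 2) (c : ℂ),
      (if z 0 = p then if z 1 = q then if z 2 = r then if z 3 = s then c else 0 else 0 else 0 else 0)
        = if z = ![p, q, r, s] then c else 0 := by
    intro z p q r s c
    simp only [← ite_and]
    congr 1
    rw [eq_iff_iff, funext_iff, Fin.forall_fin_succ, Fin.forall_fin_succ, Fin.forall_fin_succ,
      Fin.forall_fin_succ]
    simp
  simp only [hz]
  rw [Finset.sum_eq_single ![x 0 + σ 5, x 1 + σ 6, x 2 + σ 7, x 3 + σ 8] (fun z _ hne => by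
    rw [if_neg hne, mul_zero]) (by simp)]
  have h' : ∀ a b c d e f g h : ZMod 2, a + e + (b + f) + (c + g) + (d + h) = 0 ↔
      a + b + c + d = e + f + g + h := by
    intro a b c d e f g h
    rw [← CharTwo.add_eq_zero (a := a + b + c + d)]
    ring_nf
  simp only [if_true, Matrix.smul_apply, zProj, Matrix.of_apply, Matrix.cons_val, smul_eq_mul, h',
    ite_and]
  split_ifs <;> simp
end Concrete

/-! ### Enumerating the noise -/

section Enumerate

variable {W : Type} [DecidableEq W] {m : ℕ}

/-- Pairs of wires covering the outputs of a noisy elementary operation. -/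
def Step.sites : Step W m → List (W × W)
  | ⟨.prepZ q, .noisy⟩ => [(q, q)]
  | ⟨.prepX q, .noisy⟩ => [(q, q)]
  | ⟨.corrZ q _, .noisy⟩ => [(q, q)]
  | ⟨.cnot c t, .noisy⟩ => [(c, t)]
  | ⟨.measZ _ _, .noisy⟩ => []
  | ⟨.measX _ _, .noisy⟩ => []
  | _ => []

/-- The operation is a noisy elementary one or a fault-free one. -/
def Step.Simple (s : Step W m) : Prop := (s.gate.Elementary ∧ s.level = .noisy) ∨ s.level = .faultFree

theorem pauliAt_add_pauliAt_eq {c t : W} {p : W → Pauli}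
    (hp : ∀ w, w ∉ ({c, t} : Finset W) → p w = 0) :
    ∃ p' : Pauli, p = pauliAt c (p c) + pauliAt t p' := by
  by_cases h : c = t
  -- Operations with one output are listed as sites `(q, q)`, so the case of equal wires does occur.
  · refine ⟨0, funext fun w => ?_⟩
    by_cases hw : w = c
    · simp [hw, pauliAt]
    · simp [hw, pauliAt, hp w (by simp [hw, ← h])]
  · refine ⟨p t, funext fun w => ?_⟩
    by_cases hw : w = c
    · subst hw; simp [pauliAt, h]
    · by_cases hw' : w = t
      · subst hw'; simp [pauliAt, hw]
      · simp [hw, hw', pauliAt, hp w (by simp [hw, hw'])]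

theorem faultAt_zero {W : Type} (t : ℕ) : faultAt t (0 : W → Pauli) = 0 := by
  funext t' w
  simp [faultAt]

end Enumerate

namespace Circuit

variable {d a m r : ℕ}

/-- Measurement flips, the only atoms spread over two times, need a noisy or fault-tolerant Pauli
measurement, and simple circuits have none. Each atom is thus one Pauli on a live wire, or two on
the outputs of one operation, or trivial. -/
theorem forall_noise {C : Circuit d a m r} (hC : ∀ s ∈ C.steps, s.Simple)
    {P : Fault (Fin d ⊕ Fin a) → Prop}
    (h0 : P 0)
    (h1 : ∀ t ∈ List.range (C.steps.length + 1), ∀ q, q ∈ C.live t →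
      ∀ p, P (faultAt t (pauliAt q p)))
    (h2 : ∀ s ∈ C.steps.zipIdx, ∀ c ∈ s.1.sites, ∀ p p',
      P (faultAt (s.2 + 1) (pauliAt c.1 p + pauliAt c.2 p'))) :
    ∀ A, C.Noise A → P A := by
  intro A hA
  induction hA with
  | qubitFlip t ht q hq p => exact h1 t (List.mem_range.2 (Nat.lt_succ_of_le ht)) q hq p
  | gateFault t g hg p hp =>
    have hs := hC _ (List.mem_of_getElem? hg)
    have key : ∀ c ∈ (⟨g, .noisy⟩ : Step (Fin d ⊕ Fin a) m).sites, g.outputs = {c.1, c.2} →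
        P (faultAt (t + 1) p) := by
      intro c hc ho
      obtain ⟨p', hp'⟩ := pauliAt_add_pauliAt_eq (c := c.1) (t := c.2) (p := p) (by rwa [ho] at hp)
      rw [hp']
      exact h2 (⟨g, .noisy⟩, t) (List.mk_mem_zipIdx_iff_getElem?.2 hg) c hc _ _
    rcases hs with ⟨hs, -⟩ | hs
    swap
    · cases hs
    cases g with
    | prepZ q => exact key (q, q) (List.mem_singleton_self _) (by simp [Gate.outputs])
    | prepX q => exact key (q, q) (List.mem_singleton_self _) (by simp [Gate.outputs])
    | cnot c t => exact key (c, t) (List.mem_singleton_self _) rfl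
    | corrZ q k => exact key (q, q) (List.mem_singleton_self _) (by simp [Gate.outputs])
    | measZ q k => rwa [show p = 0 from funext fun w => hp w (Finset.notMem_empty w), faultAt_zero]
    | measX q k => rwa [show p = 0 from funext fun w => hp w (Finset.notMem_empty w), faultAt_zero]
    | measPauliZ s k => exact absurd hs id
    | catState q => exact absurd hs id
    | catLike q => exact absurd hs id
  | measFlip t s k hg f hf hanti p hp =>
    rcases hC _ (List.mem_of_getElem? hg) with ⟨h, -⟩ | h
    · exact absurd h id
    · cases h
  | measFlipFT t s k hg f hf hanti q hq p =>
    rcases hC _ (List.mem_of_getElem? hg) with ⟨h, -⟩ | h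
    · exact absurd h id
    · cases h

end Circuit

/-! ### Effects of weight one -/

/-- Evaluates the bit before passing it on. -/
def force (x : ZMod 2) (k : ZMod 2 → Bool) : Bool := if x = 0 then k 0 else k 1

theorem force_eq (x : ZMod 2) (k : ZMod 2 → Bool) : force x k = k x := by
  have h : ∀ x : ZMod 2, x = 0 ∨ x = 1 := by decide
  rcases h x with rfl | rfl <;> rfl

/-- Evaluates the Pauli before passing it on. -/
def forcePauli (p : Pauli) (k : Pauli → Bool) : Bool := force p.1 fun x => force p.2 fun z => k (x, z)

theorem forcePauli_eq (p : Pauli) (k : Pauli → Bool) : forcePauli p k = k p := by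
  rw [forcePauli, force_eq, force_eq]

/-- Evaluates the four Paulis before deciding a property of them. -/
def forceDecide (Q : (Fin 4 → Pauli) → Prop) [DecidablePred Q] (P : Fin 4 → Pauli) : Bool :=
  forcePauli (P 0) fun p0 => forcePauli (P 1) fun p1 => forcePauli (P 2) fun p2 =>
    forcePauli (P 3) fun p3 => decide (Q ![p0, p1, p2, p3])

theorem forceDecide_iff (Q : (Fin 4 → Pauli) → Prop) [DecidablePred Q] (P : Fin 4 → Pauli) :
    forceDecide Q P = true ↔ Q P := by
  simp only [forceDecide, forcePauli_eq, decide_eq_true_eq]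
  rw [show ![P 0, P 1, P 2, P 3] = P by ext i <;> fin_cases i <;> rfl]

/-- The Pauli string `ZZZZ`. -/
def stabZ : Fin 4 → Pauli := fun _ => (0, 1)

/-- Up to `ZZZZ`, the Pauli string acts on at most one qubit. -/
def WeightOneZ (P : Fin 4 → Pauli) : Prop := ∃ (c : ZMod 2) (i : Fin 4), ∀ j, j ≠ i → P j = (0, c)

/-- The propagated Paulis are evaluated before the search over `c` and `i`, which would otherwise
repeat the propagation at every lookup. -/
instance : DecidablePred WeightOneZ := fun P =>
  decidable_of_iff _ (forceDecide_iff
    (fun P => ∃ (c : ZMod 2) (i : Fin 4), ∀ j, j ≠ i → P j = (0, c)) P)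

/-- The effects of detectable atomic faults. -/
def HalfFlipZ (P : Fin 4 → Pauli) : Prop :=
  ∃ z ∈ [![0, 0, 0, 0], ![1, 0, 0, 0], ![0, 1, 0, 0], ![1, 0, 1, (0 : ZMod 2)]],
    ∃ c : ZMod 2, ∀ i, P i = (0, z i + c)

instance : DecidablePred HalfFlipZ := fun P =>
  decidable_of_iff _ (forceDecide_iff
    (fun P => ∃ z ∈ [![0, 0, 0, 0], ![1, 0, 0, 0], ![0, 1, 0, 0], ![1, 0, 1, (0 : ZMod 2)]],
      ∃ c : ZMod 2, ∀ i, P i = (0, z i + c)) P)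

/-- The Pauli string `XX`. -/
def stabX : Fin 2 → Pauli := fun _ => (1, 0)

/-- The effect of a single-qubit Pauli before or after the cat-like map. -/
def WeightOneX (e : (Fin 2 → Pauli) × ZMod 2) : Prop :=
  ∃ (i : Fin 2) (p : Pauli) (c : ZMod 2), (e.1 0 = pauliAt i p 0 + (c, 0) ∧
    e.1 1 = pauliAt i p 1 + (c, 0)) ∧ (e.2 = 0 ∨ e.2 = p.2)

instance : DecidablePred WeightOneX := fun e => by unfold WeightOneX; infer_instance

namespace Circuit

/-! ### The normal forms -/

/-- The normal form of the specification. -/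
def normalFormZZZZ : NormalForm zzzzMeasurement zProj (fun v => v 0) where
  mismatch _ := 0
  mismatch_add _ _ := rfl
  shift _ := 0
  shift_add _ _ := rfl
  sign σ := σ 0
  sign_add _ _ := rfl
  scale := 1
  scale_pos := one_pos
  signedKraus_of_eq σ _ := UpToSign.of_eq (by
    rw [signedKraus_zzzz, pauliMatrix_zero, Complex.ofReal_one, one_smul, one_mul])
  signedKraus_of_ne σ h := absurd rfl h
  check := ∅
  mismatch_settings _ := rfl
  satisfies_iff o := by simp [Satisfies, zzzzMeasurement]
  shift_settings _ _ := rfl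
  sign_settings o v _ h := by
    rw [← h 0]
    simp [zzzzMeasurement, settings, Gate.setting]
  count := 1
  count_pos := one_pos
  card_outcomes := by decide

/-- The normal form of the Shor-style circuit. -/
def normalFormShor : NormalForm shorCircuit zProj (fun v => v 0) where
  mismatch _ := 0
  mismatch_add _ _ := rfl
  shift _ := 0
  shift_add _ _ := rfl
  sign σ := σ 5 + σ 6 + σ 7 + σ 8
  sign_add σ τ := by simp only [Pi.add_apply]; ring
  scale := 1 / 2
  scale_pos := by norm_num
  signedKraus_of_eq σ _ := UpToSign.of_eq (by
    rw [signedKraus_shor, pauliMatrix_zero, one_mul]; norm_num)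
  signedKraus_of_ne σ h := absurd rfl h
  check := ∅
  mismatch_settings _ := rfl
  satisfies_iff o := by simp [Satisfies, shorCircuit]
  shift_settings _ _ := rfl
  sign_settings o v _ h := by
    rw [← h 0]
    simp [shorCircuit, settings, Gate.setting, add_assoc]
  -- Four outcome bits of prescribed parity.
  count := 8
  count_pos := by norm_num
  card_outcomes := by decide +kernel

/-- The normal form of the optimised circuit. -/
def normalFormOptimised : NormalForm optimisedCircuit zProj (fun v => v 0) where
  mismatch _ := 0
  mismatch_add _ _ := rfl
  shift σ := fun i => (0, ![σ 4, 0, σ 4, 0] i)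
  shift_add σ τ := by
    funext i; fin_cases i <;> rfl
  sign σ := σ 7 + σ 8
  sign_add σ τ := by simp only [Pi.add_apply]; ring
  scale := 1 / 2
  scale_pos := by norm_num
  signedKraus_of_eq σ _ := by
    have h := signedKraus_optimised σ
    norm_num at h ⊢
    exact h
  signedKraus_of_ne σ h := absurd rfl h
  check := ∅
  mismatch_settings _ := rfl
  satisfies_iff o := by simp [Satisfies, optimisedCircuit]
  shift_settings o _ := by
    funext i; fin_cases i <;> rfl
  sign_settings o v _ h := by
    rw [← h 0]
    simp [optimisedCircuit, settings, Gate.setting]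
  count := 2
  count_pos := by norm_num
  card_outcomes := by decide +kernel

/-- The normal form of the complete circuit. -/
def normalFormComplete : NormalForm completeCircuit zProj (fun v => v 0) where
  mismatch σ := σ 7 + σ 12
  mismatch_add σ τ := by simp only [Pi.add_apply]; ring
  shift σ := fun i => (0, ![σ 8 + σ 12, 0, σ 13 + σ 12, 0] i)
  shift_add σ τ := by
    funext i
    fin_cases i <;> simp <;> ring
  sign σ := σ 16 + σ 17
  sign_add σ τ := by simp only [Pi.add_apply]; ring
  scale := 1 / 2
  scale_pos := by norm_num
  signedKraus_of_eq σ h := by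
    have h := signedKraus_complete σ (CharTwo.add_eq_zero.1 h)
    norm_num at h ⊢
    exact h
  signedKraus_of_ne σ h := signedKraus_complete_of_ne σ fun e => h (CharTwo.add_eq_zero.2 e)
  check := {0, 1}
  mismatch_settings o := by simp [completeCircuit, xxMeasurement, settings, Gate.setting]
  satisfies_iff o := by simp [Satisfies, completeCircuit]
  -- With equal `XX` outcomes the parameters `8`, `12` and `13` coincide, so both corrections cancel
  -- the string left by the eigenvalue.
  shift_settings o h := by
    have h : o 0 = o 1 := by simpa [CharTwo.add_eq_zero] using h
    funext i
    fin_cases i <;> simp [completeCircuit, xxMeasurement, settings, Gate.setting, h, CharTwo.add_self_eq_zero]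
  sign_settings o v _ h := by
    rw [← h 0]
    simp [completeCircuit, xxMeasurement, settings, Gate.setting]
  -- Two choices of the common `XX` outcome, times two pairs of final outcomes of the reported
  -- parity.
  count := 4
  count_pos := by norm_num
  card_outcomes := by decide +kernel

/-- The normal form of the cat-like map. -/
def normalFormCatLike : NormalForm catLikeCircuit xProj (fun _ => 0) where
  mismatch _ := 0
  mismatch_add _ _ := rfl
  shift _ := 0
  shift_add _ _ := rfl
  sign σ := σ 0
  sign_add _ _ := rfl
  scale := 1
  scale_pos := one_pos
  signedKraus_of_eq σ _ := UpToSign.of_eq (by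
    rw [signedKraus_catLike, pauliMatrix_zero, Complex.ofReal_one, one_smul, one_mul])
  signedKraus_of_ne σ h := absurd rfl h
  check := ∅
  mismatch_settings _ := rfl
  satisfies_iff o := by simp [Satisfies, catLikeCircuit]
  shift_settings _ _ := rfl
  sign_settings _ _ _ _ := rfl
  count := 1
  count_pos := one_pos
  card_outcomes := by decide

/-- The normal form of the implementation of the cat-like map. -/
def normalFormImplementation : NormalForm catLikeImplementation xProj (fun _ => 0) where
  mismatch σ := σ 4 + σ 8
  mismatch_add σ τ := by simp only [Pi.add_apply]; ring
  shift σ := fun i => (0, ![σ 0 + σ 9, 0] i)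
  shift_add σ τ := by
    funext i
    fin_cases i <;> simp <;> ring
  -- The first correction and the second outcome carry equal bits, so the fault-free circuit always
  -- projects onto the eigenvalue `+1`.
  sign σ := σ 0 + σ 8
  sign_add σ τ := by simp only [Pi.add_apply]; ring
  scale := 1
  scale_pos := one_pos
  signedKraus_of_eq σ h := UpToSign.of_eq (by
    rw [signedKraus_impl σ (CharTwo.add_eq_zero.1 h), Complex.ofReal_one, one_smul])
  signedKraus_of_ne σ h := signedKraus_impl_of_ne σ fun e => h (CharTwo.add_eq_zero.2 e)
  check := {0, 1}
  mismatch_settings o := by simp [catLikeImplementation, xxMeasurement, settings, Gate.setting]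
  satisfies_iff o := by simp [Satisfies, catLikeImplementation]
  shift_settings o h := by
    have h : o 0 = o 1 := by simpa [CharTwo.add_eq_zero] using h
    funext i
    fin_cases i <;> simp [catLikeImplementation, xxMeasurement, settings, Gate.setting, h, CharTwo.add_self_eq_zero]
  sign_settings o v h _ := by
    have h : o 0 = o 1 := by simpa [CharTwo.add_eq_zero] using h
    simp [catLikeImplementation, xxMeasurement, settings, Gate.setting, h, CharTwo.add_self_eq_zero]
  count := 2
  count_pos := by norm_num
  card_outcomes := by decide +kernel

end Circuit

/-! ### Faults at a single time -/

section Late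

variable {W : Type} [DecidableEq W] {m : ℕ}

/-- The Pauli string after the operations `l` equivalent to the string `p` before them. -/
def pushAll : List (Step W m) → (W → Pauli) → W → Pauli
  | [], p => p
  | s :: l, p => pushAll l (s.gate.push p)

/-- The sign parameters flipped by the string `p` before the operations `l`. -/
def pushFlips : List (Step W m) → (W → Pauli) → ℕ → ZMod 2
  | [], _, _ => 0
  | s :: _, p, 0 => s.gate.flip p
  | s :: l, p, n + 1 => pushFlips l (s.gate.push p) n

/-- The operations `l` can be exchanged with the string `p` before them. -/
def PushMovable : List (Step W m) → (W → Pauli) → Prop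
  | [], _ => True
  | s :: l, p => s.gate.Passes p ∧ PushMovable l (s.gate.push p)

/-- The sign parameters of the operations `l` flipped by the string `p` at time `t`. -/
def lateFlips : ℕ → List (Step W m) → (W → Pauli) → ℕ → ZMod 2
  | 0, l, p, n => pushFlips l p n
  | _ + 1, [], _, _ => 0
  | _ + 1, _ :: _, _, 0 => 0
  | t + 1, _ :: l, p, n + 1 => lateFlips t l p n

theorem frame_faultAt_zero (l : List (Step W m)) (p p' : W → Pauli) :
    frame l p (faultAt 0 p') = pushAll l (p + p') ∧ flips l p (faultAt 0 p') = pushFlips l (p + p') ∧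
      (Movable l p (faultAt 0 p') ↔ PushMovable l (p + p')) := by
  induction l generalizing p p' with
  | nil => exact ⟨rfl, rfl, Iff.rfl⟩
  | cons s l ih =>
    -- Nothing is left of the fault after the first operation; writing it as a trivial fault at time
    -- `0` makes the induction hypothesis apply.
    have e : (fun t => (faultAt 0 p' : Fault W) (t + 1)) = faultAt 0 0 := by
      funext t w
      simp [faultAt]
    have e0 : p + (faultAt 0 p' : Fault W) 0 = p + p' := rfl
    obtain ⟨h1, h2, h3⟩ := ih (s.gate.push (p + p')) 0
    rw [add_zero] at h1 h2 h3
    refine ⟨?_, ?_, ?_⟩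
    · rw [frame, e, e0, h1, pushAll]
    · funext n
      cases n with
      | zero => rfl
      | succ n => rw [flips, e, e0, h2, pushFlips]
    · rw [Movable, e, e0, h3, PushMovable]

theorem Gate.push_zero (g : Gate W m) : g.push (0 : W → Pauli) = 0 := by
  have h := g.push_add 0 0
  rwa [add_zero, left_eq_add] at h

theorem Gate.flip_zero (g : Gate W m) : g.flip (0 : W → Pauli) = 0 := by
  have h := g.flip_add 0 0
  rwa [add_zero, left_eq_add] at h

theorem faultAt_succ (t : ℕ) (p : W → Pauli) :
    (fun n => (faultAt (t + 1) p : Fault W) (n + 1)) = faultAt t p := by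
  funext n w
  simp [faultAt]

theorem frame_faultAt (t : ℕ) (l : List (Step W m)) (ht : t ≤ l.length) (p : W → Pauli) :
    frame l 0 (faultAt t p) = pushAll (l.drop t) p := by
  induction t generalizing l with
  | zero =>
    have h := (frame_faultAt_zero l 0 p).1
    rwa [zero_add] at h
  | succ t ih =>
    cases l with
    | nil => exact absurd ht (Nat.not_succ_le_zero t)
    | cons s l =>
      rw [frame, faultAt_succ, List.drop_succ_cons, ← ih l (Nat.le_of_succ_le_succ ht)]
      congr 1
      exact Gate.push_zero _

theorem flips_faultAt (t : ℕ) (l : List (Step W m)) (ht : t ≤ l.length) (p : W → Pauli) :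
    flips l 0 (faultAt t p) = lateFlips t l p := by
  induction t generalizing l with
  | zero =>
    have h := (frame_faultAt_zero l 0 p).2.1
    rw [zero_add] at h
    rw [h]
    rfl
  | succ t ih =>
    cases l with
    | nil => exact absurd ht (Nat.not_succ_le_zero t)
    | cons s l =>
      have e : s.gate.push (0 + (faultAt (t + 1) p : Fault W) 0) = 0 := Gate.push_zero _
      funext n
      cases n with
      | zero => exact Gate.flip_zero _
      | succ n => rw [flips, faultAt_succ, e, ih l (Nat.le_of_succ_le_succ ht), lateFlips]

/-- Before time `t` the travelling string is trivial, but the operations must still be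
nondegenerate; this is what `h0` supplies. -/
theorem movable_faultAt (t : ℕ) (l : List (Step W m)) (ht : t ≤ l.length) (p : W → Pauli)
    (h0 : PushMovable l 0) (hp : PushMovable (l.drop t) p) : Movable l 0 (faultAt t p) := by
  induction t generalizing l with
  | zero =>
    have h := (frame_faultAt_zero l 0 p).2.2
    rw [zero_add] at h
    exact h.2 hp
  | succ t ih =>
    cases l with
    | nil => exact absurd ht (Nat.not_succ_le_zero t)
    | cons s l =>
      have e : s.gate.push (0 + (faultAt (t + 1) p : Fault W) 0) = 0 := Gate.push_zero _
      rw [PushMovable, Gate.push_zero] at h0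
      refine ⟨h0.1, ?_⟩
      rw [faultAt_succ, e]
      exact ih l (Nat.le_of_succ_le_succ ht) h0.2 hp

/-! ### Evaluation with booleans -/

/-- The bit of a boolean. -/
def bit (b : Bool) : ZMod 2 := cond b 1 0

/-- The Pauli `X^x Z^z` for booleans `(x, z)`. -/
def bitPauli (b : Bool × Bool) : Pauli := (bit b.1, bit b.2)

theorem bit_xor (b c : Bool) : bit (b ^^ c) = bit b + bit c := by
  cases b <;> cases c <;> rfl

theorem exists_bitPauli : ∀ p : Pauli, ∃ b, p = bitPauli b := by decide

/-- `Gate.push` for booleans. -/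
def Gate.pushBool (p : W → Bool × Bool) : Gate W m → W → Bool × Bool
  | .cnot c t => fun w =>
      (cond (decide (w = t)) ((p w).1 ^^ (p c).1) (p w).1,
        cond (decide (w = c)) ((p w).2 ^^ (p t).2) (p w).2)
  | .measZ q _ => fun w => cond (decide (w = q)) (false, false) (p w)
  | .measX q _ => fun w => cond (decide (w = q)) (false, false) (p w)
  | _ => p

/-- `Gate.flip` for booleans, where operations on several qubits are not evaluated. -/
def Gate.flipBool (p : W → Bool × Bool) : Gate W m → Bool
  | .measZ q _ => (p q).1
  | .measX q _ => (p q).2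
  | .catLike q => (p (q 0)).2 ^^ (p (q 1)).2
  | _ => false

/-- `Gate.Passes` for booleans, for operations other than measurements of several qubits. -/
def Gate.passesBool (p : W → Bool × Bool) : Gate W m → Bool
  | .prepZ q => !((p q).1 || (p q).2)
  | .prepX q => !((p q).1 || (p q).2)
  | .catState q => (List.finRange 4).all fun i => !((p (q i)).1 || (p (q i)).2)
  | .cnot c t => !decide (c = t)
  | .catLike q => !decide (q 0 = q 1)
  | .measPauliZ _ _ => false
  | _ => true

/-- The boolean copy of the propagation lets the finite checks run on boolean case distinctions
instead of arithmetic in `ZMod 2`. -/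
theorem Gate.push_bitPauli (p : W → Bool × Bool) (g : Gate W m) :
    g.push (fun w => bitPauli (p w)) = fun w => bitPauli (g.pushBool p w) := by
  cases g <;> try rfl
  · rename_i c t
    funext w
    simp only [push, pushBool]
    refine Prod.ext ?_ ?_
    · by_cases h : w = t
      · rw [if_pos h, decide_eq_true h, cond_true]
        split_ifs <;> simp [bitPauli, bit_xor]
      · rw [if_neg h, decide_eq_false h, cond_false]
        split_ifs <;> simp [bitPauli]
    · by_cases h : w = c
      · rw [if_pos h, decide_eq_true h, cond_true]
        split_ifs <;> simp [bitPauli, bit_xor]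
      · rw [if_neg h, decide_eq_false h, cond_false]
        split_ifs <;> simp [bitPauli]
  all_goals
    funext w
    simp only [push, pushBool]
    split_ifs with h <;> simp only [h, decide_true, decide_false, cond_true, cond_false] <;> rfl

theorem Gate.flip_bitPauli (p : W → Bool × Bool) (g : Gate W m) (h : g.passesBool p) :
    g.flip (fun w => bitPauli (p w)) = bit (g.flipBool p) := by
  cases g <;> try rfl
  · exact absurd h (by simp [passesBool])
  · simp [flip, flipBool, bit_xor, bitPauli]

theorem Gate.passes_bitPauli (p : W → Bool × Bool) (g : Gate W m) (h : g.passesBool p) :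
    g.Passes (fun w => bitPauli (p w)) := by
  cases g <;> simp_all [passesBool, Passes, bitPauli, bit]

/-- `pushAll` for booleans. -/
def pushAllBool : List (Step W m) → (W → Bool × Bool) → W → Bool × Bool
  | [], p => p
  | s :: l, p => pushAllBool l (s.gate.pushBool p)

/-- `pushFlips` for booleans. -/
def pushFlipsBool : List (Step W m) → (W → Bool × Bool) → ℕ → Bool
  | [], _, _ => false
  | s :: _, p, 0 => s.gate.flipBool p
  | s :: l, p, n + 1 => pushFlipsBool l (s.gate.pushBool p) n

/-- `PushMovable` for booleans. -/
def pushMovableBool : List (Step W m) → (W → Bool × Bool) → Bool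
  | [], _ => true
  | s :: l, p => s.gate.passesBool p && pushMovableBool l (s.gate.pushBool p)

/-- `lateFlips` for booleans. -/
def lateFlipsBool : ℕ → List (Step W m) → (W → Bool × Bool) → ℕ → Bool
  | 0, l, p, n => pushFlipsBool l p n
  | _ + 1, [], _, _ => false
  | _ + 1, _ :: _, _, 0 => false
  | t + 1, _ :: l, p, n + 1 => lateFlipsBool t l p n

theorem pushAll_bitPauli (l : List (Step W m)) (p : W → Bool × Bool) :
    pushAll l (fun w => bitPauli (p w)) = fun w => bitPauli (pushAllBool l p w) := by
  induction l generalizing p with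
  | nil => rfl
  | cons s l ih => rw [pushAll, Gate.push_bitPauli, ih, pushAllBool]

theorem pushMovable_bitPauli (l : List (Step W m)) (p : W → Bool × Bool)
    (h : pushMovableBool l p) : PushMovable l (fun w => bitPauli (p w)) := by
  induction l generalizing p with
  | nil => trivial
  | cons s l ih =>
    rw [pushMovableBool, Bool.and_eq_true] at h
    rw [PushMovable, Gate.push_bitPauli]
    exact ⟨s.gate.passes_bitPauli p h.1, ih _ h.2⟩

theorem pushFlips_bitPauli (l : List (Step W m)) (p : W → Bool × Bool)
    (h : pushMovableBool l p) (n : ℕ) :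
    pushFlips l (fun w => bitPauli (p w)) n = bit (pushFlipsBool l p n) := by
  induction l generalizing p n with
  | nil => rfl
  | cons s l ih =>
    rw [pushMovableBool, Bool.and_eq_true] at h
    cases n with
    | zero => exact s.gate.flip_bitPauli p h.1
    | succ n => rw [pushFlips, Gate.push_bitPauli, ih _ h.2, pushFlipsBool]

theorem lateFlips_bitPauli (t : ℕ) (l : List (Step W m)) (p : W → Bool × Bool)
    (h : pushMovableBool (l.drop t) p) (n : ℕ) :
    lateFlips t l (fun w => bitPauli (p w)) n = bit (lateFlipsBool t l p n) := by
  induction t generalizing l n with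
  | zero => exact pushFlips_bitPauli l p h n
  | succ t ih =>
    cases l with
    | nil => rfl
    | cons s l =>
      cases n with
      | zero => rfl
      | succ n => exact ih l h n

/-- `pauliAt` for booleans. -/
def pauliAtBool (q : W) (p : Bool × Bool) (w : W) : Bool × Bool :=
  cond (decide (w = q)) p (false, false)

theorem pauliAt_bitPauli (q : W) (p : Bool × Bool) :
    pauliAt q (bitPauli p) = fun w => bitPauli (pauliAtBool q p w) := by
  funext w
  by_cases h : w = q <;>
    simp only [pauliAt, pauliAtBool, h, if_true, if_false, decide_true, decide_false, cond_true,
      cond_false] <;> rfl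

/-- The product of two Pauli strings for booleans. -/
def mulBool (p p' : W → Bool × Bool) (w : W) : Bool × Bool :=
  ((p w).1 ^^ (p' w).1, (p w).2 ^^ (p' w).2)

theorem bitPauli_mulBool (p p' : W → Bool × Bool) :
    (fun w => bitPauli (p w)) + (fun w => bitPauli (p' w)) = fun w => bitPauli (mulBool p p' w) := by
  funext w
  simp [mulBool, bitPauli, bit_xor]

end Late

namespace Circuit

/-! ### Reducing the noise analysis to finitely many Pauli strings -/

section Sound

variable {d a m r : ℕ} {C : Circuit d a m r}
  {proj : ZMod 2 → Matrix (Fin d → ZMod 2) (Fin d → ZMod 2) ℂ} {base : (Fin r → ZMod 2) → ZMod 2}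

/-- The fault is movable, and its effect satisfies `R` or `D`, depending on its syndrome. -/
def NormalForm.Sound (N : NormalForm C proj base) (R D : (Fin d → Pauli) × ZMod 2 → Prop)
    (F : Fault (Fin d ⊕ Fin a)) : Prop :=
  C.Movable F ∧ (N.syndrome F = 0 → R (N.effect F)) ∧ (N.syndrome F ≠ 0 → D (N.effect F))

/-- `Sound` for the Pauli string `p` at time `t`. -/
def NormalForm.SoundAt (N : NormalForm C proj base) (R D : (Fin d → Pauli) × ZMod 2 → Prop)
    (t : ℕ) (p : Fin d ⊕ Fin a → Bool × Bool) : Prop :=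
  (pushMovableBool (C.steps.drop t) p = true ∧
    ∀ j, pushAllBool (C.steps.drop t) p (Sum.inr j) = (false, false)) ∧
  if N.mismatch (fun n => bit (lateFlipsBool t C.steps p n)) = 0 then
    R (fun i => bitPauli (pushAllBool (C.steps.drop t) p (Sum.inl i)) +
        N.shift (fun n => bit (lateFlipsBool t C.steps p n)) i,
      N.sign (fun n => bit (lateFlipsBool t C.steps p n)))
  else
    D (fun i => bitPauli (pushAllBool (C.steps.drop t) p (Sum.inl i)) +
        N.shift (fun n => bit (lateFlipsBool t C.steps p n)) i,
      N.sign (fun n => bit (lateFlipsBool t C.steps p n)))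

instance (N : NormalForm C proj base) (R D : (Fin d → Pauli) × ZMod 2 → Prop) [DecidablePred R]
    [DecidablePred D] (t : ℕ) (p : Fin d ⊕ Fin a → Bool × Bool) : Decidable (N.SoundAt R D t p) :=
  inferInstanceAs (Decidable ((_ ∧ _) ∧ ite _ _ _))

theorem NormalForm.SoundAt.sound {N : NormalForm C proj base}
    {R D : (Fin d → Pauli) × ZMod 2 → Prop} (h0 : PushMovable C.steps 0) {t : ℕ}
    (ht : t ≤ C.steps.length) {p : Fin d ⊕ Fin a → Bool × Bool} (h : N.SoundAt R D t p) :
    N.Sound R D (faultAt t fun w => bitPauli (p w)) := by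
  obtain ⟨⟨h1, h2⟩, h3⟩ := h
  have hf := frame_faultAt t _ ht fun w => bitPauli (p w)
  rw [pushAll_bitPauli] at hf
  have hl : flips C.steps 0 (faultAt t fun w => bitPauli (p w))
      = fun n => bit (lateFlipsBool t C.steps p n) := by
    rw [flips_faultAt t _ ht]
    exact funext (lateFlips_bitPauli t _ p h1)
  refine ⟨⟨movable_faultAt t _ ht _ h0 (pushMovable_bitPauli _ _ h1), fun j => ?_⟩, ?_⟩
  · rw [hf]
    change bitPauli (pushAllBool _ p (Sum.inr j)) = 0
    rw [h2]
    rfl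
  have e : N.effect (faultAt t fun w => bitPauli (p w)) =
      (fun i => bitPauli (pushAllBool (C.steps.drop t) p (Sum.inl i)) +
        N.shift (fun n => bit (lateFlipsBool t C.steps p n)) i,
      N.sign (fun n => bit (lateFlipsBool t C.steps p n))) := by
    rw [effect, hl]
    refine Prod.ext (funext fun i => ?_) rfl
    change frame C.steps 0 (faultAt t _) (Sum.inl i) + _ = _
    rw [hf]
  rw [syndrome, e, hl]
  refine ⟨fun hs => by rwa [if_pos hs] at h3, fun hs => by rwa [if_neg hs] at h3⟩

/-- Soundness of all atomic faults follows from that of finitely many Pauli strings. -/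
theorem NormalForm.sound_of_soundAt {N : NormalForm C proj base}
    {R D : (Fin d → Pauli) × ZMod 2 → Prop} (hC : ∀ s ∈ C.steps, s.Simple)
    (hz : N.SoundAt R D 0 fun _ => (false, false))
    (h1 : ∀ t ∈ List.range (C.steps.length + 1), ∀ q, q ∈ C.live t →
      ∀ p, N.SoundAt R D t (pauliAtBool q p))
    (h2 : ∀ s ∈ C.steps.zipIdx, ∀ c ∈ s.1.sites, ∀ p p',
      N.SoundAt R D (s.2 + 1) (mulBool (pauliAtBool c.1 p) (pauliAtBool c.2 p'))) :
    (∀ A, C.Noise A → N.Sound R D A) ∧ C.Movable 0 := by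
  have h0 : PushMovable C.steps 0 := pushMovable_bitPauli _ _ hz.1.1
  have hz' : N.Sound R D 0 := by
    have h := hz.sound h0 (Nat.zero_le _)
    rwa [show (fun w => bitPauli (false, false)) = (0 : Fin d ⊕ Fin a → Pauli) from rfl,
      faultAt_zero] at h
  refine ⟨forall_noise hC hz' (fun t ht q hq p => ?_) (fun s hs c hc p p' => ?_), hz'.1⟩
  · obtain ⟨b, rfl⟩ := exists_bitPauli p
    rw [pauliAt_bitPauli]
    exact (h1 t ht q hq b).sound h0 (Nat.le_of_lt_succ (List.mem_range.1 ht))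
  · obtain ⟨b, rfl⟩ := exists_bitPauli p
    obtain ⟨b', rfl⟩ := exists_bitPauli p'
    rw [pauliAt_bitPauli, pauliAt_bitPauli, bitPauli_mulBool]
    exact (h2 s hs c hc b b').sound h0 (Nat.succ_le_of_lt (by
      have := List.snd_lt_of_mem_zipIdx hs
      simpa using this))

end Sound

end Circuit

/-! ### Stabilisers -/

theorem stabZ_mul_zProj (s : ZMod 2) : UpToSign (pauliMatrix stabZ * zProj s) (zProj s) := by
  refine ⟨s, ?_⟩
  ext y x
  rw [show stabZ = fun i => (0, (fun _ => 1 : Fin 4 → ZMod 2) i) from rfl,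
    pauliMatrix_z_mul_apply, Matrix.smul_apply, zProj, Matrix.of_apply, smul_eq_mul]
  by_cases h : y = x ∧ x 0 + x 1 + x 2 + x 3 = s
  · rw [if_pos h, h.1, ← h.2, Fin.sum_univ_four]
    simp only [one_mul]
  · rw [if_neg h, mul_zero, mul_zero]

/-- Multiplying by `XX` toggles whether both bits flip, so `v` is reindexed by `v + 1` at the cost
of the eigenvalue `(-1)^s`. -/
theorem stabX_mul_xProj (s : ZMod 2) : UpToSign (pauliMatrix stabX * xProj s) (xProj s) := by
  refine ⟨s, ?_⟩
  ext y x
  rw [pauliMatrix_mul_apply, Matrix.smul_apply, xProj, Matrix.of_apply, Matrix.of_apply,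
    smul_eq_mul, Finset.mul_sum, Finset.mul_sum,
    ← Equiv.sum_comp (Equiv.addRight (1 : ZMod 2)) fun v => sgn _ * _]
  refine Finset.sum_congr rfl fun v _ => ?_
  have h : (y + xPart stabX = ![x 0 + (v + 1), x 1 + (v + 1)]) ↔ y = ![x 0 + v, x 1 + v] := by
    rw [show ![x 0 + (v + 1), x 1 + (v + 1)] = ![x 0 + v, x 1 + v] + xPart stabX by
      funext i; fin_cases i <;> simp [xPart, stabX, add_assoc], add_left_inj]
  have hz : ∑ w, zPart stabX w * (y + xPart stabX) w = 0 := by simp [zPart, stabX]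
  rw [Equiv.coe_addRight, hz, sgn_zero, one_mul]
  simp only [h]
  split_ifs
  · rw [mul_add, mul_one, add_comm, sgn_add, mul_div_assoc]
  · rw [mul_zero]

namespace Circuit

/-! ### Noise analysis of the `ZZZZ` measurements -/

/-- The product of two half flips is the product of two Paulis on single qubits, up to `ZZZZ`. -/
theorem halfFlipZ_add {P P' : Fin 4 → Pauli} (h : HalfFlipZ P) (h' : HalfFlipZ P') :
    ∃ i, WeightOneZ (P + P' + pauliAt i (0, 1)) := by
  have key : ∀ z ∈ [![0, 0, 0, 0], ![1, 0, 0, 0], ![0, 1, 0, 0], ![1, 0, 1, (0 : ZMod 2)]],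
      ∀ z' ∈ [![0, 0, 0, 0], ![1, 0, 0, 0], ![0, 1, 0, 0], ![1, 0, 1, (0 : ZMod 2)]],
      ∀ c c' : ZMod 2, ∃ i, WeightOneZ
        ((fun i => (0, z i + c)) + (fun i => (0, z' i + c')) + pauliAt i (0, 1)) := by
    decide +kernel
  obtain ⟨z, hz, c, hP⟩ := h
  obtain ⟨z', hz', c', hP'⟩ := h'
  rw [funext hP, funext hP']
  exact key z hz z' hz' c c'

theorem weightOneZ_pauliAt (i : Fin 4) (p : Pauli) : WeightOneZ (pauliAt i p) :=
  ⟨0, i, fun _ hj => if_neg hj⟩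

theorem WeightOneZ.eq_pauliAt_add {P : Fin 4 → Pauli} (h : WeightOneZ P) :
    ∃ i p, ∃ c : ZMod 2, pauliAt i p = P + c • stabZ := by
  obtain ⟨c, i, h⟩ := h
  refine ⟨i, P i + (0, c), c, funext fun j => ?_⟩
  have hc : c • stabZ j = (0, c) := by simp [stabZ]
  rw [Pi.add_apply, Pi.smul_apply, hc, pauliAt]
  split_ifs with hj
  · rw [hj]
  · rw [h j hj]
    exact (CharTwo.add_self_eq_zero ((0, c) : Pauli)).symm

section Analysis

variable {a m r : ℕ}

/-- A noise analysis of a circuit in which single atomic faults have the effect of every Pauli on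
a data qubit with and without a flip of the reported bit. -/
theorem noiseAnalysis_of_soundZ {C : Circuit 4 a m 1} {N : NormalForm C zProj fun v => v 0}
    (h : (∀ A, C.Noise A → N.Sound (fun e => WeightOneZ e.1) (fun e => HalfFlipZ e.1) A) ∧
      C.Movable 0)
    (hw : ∀ i p f, ∃ A, C.Noise A ∧ N.syndrome A = 0 ∧ N.effect A = (pauliAt i p, f)) :
    NoiseAnalysis N stabZ fun e => WeightOneZ e.1 where
  movable_zero := h.2
  movable A hA := (h.1 A hA).1
  effect_mem A hA := (h.1 A hA).2.1
  effect_pair A A' hA hA' hs hs' := by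
    obtain ⟨i, hi⟩ := halfFlipZ_add ((h.1 A hA).2.2 hs) ((h.1 A' hA').2.2 hs')
    -- Membership in `R` ignores the reported bit, so its whole flip goes to the first summand.
    refine ⟨(_, (N.effect A).2 + (N.effect A').2), (pauliAt i (0, 1), 0), hi,
      weightOneZ_pauliAt i _, Prod.ext ?_ (add_zero _).symm⟩
    rw [Prod.fst_add, Prod.fst_add, add_assoc _ (pauliAt i _)]
    rw [show pauliAt i ((0, 1) : Pauli) + pauliAt i (0, 1) = 0 from
      funext fun _ => CharTwo.add_self_eq_zero _, add_zero]
  realised e he := by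
    obtain ⟨i, p, c, hp⟩ := WeightOneZ.eq_pauliAt_add he
    obtain ⟨A, h1, h2, h3⟩ := hw i p e.2
    exact ⟨A, h1, h2, c, h3.trans (Prod.ext hp (add_zero _).symm)⟩

/-- Witnesses from CNOTs with controls on the data qubits: `CNOT` number `i` is operation `τ i`
and acts on the auxiliary qubit `b i`. -/
theorem exists_noise_effect {C : Circuit 4 a m 1} {N : NormalForm C zProj fun v => v 0}
    (τ : Fin 4 → ℕ) (b : Fin 4 → Fin a)
    (hτ : ∀ i, C.steps[τ i]? = some (noisy (.cnot (dat i) (aux (b i)))))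
    (hl : ∀ i, dat i ∈ C.live C.steps.length)
    (h0 : ∀ i p, N.syndrome (faultAt C.steps.length (pauliAt (dat i) p)) = 0 ∧
      N.effect (faultAt C.steps.length (pauliAt (dat i) p)) = (pauliAt i p, 0))
    (h1 : ∀ i p,
      N.syndrome (faultAt (τ i + 1) (pauliAt (dat i) p + pauliAt (aux (b i)) (1, 0))) = 0 ∧
      N.effect (faultAt (τ i + 1) (pauliAt (dat i) p + pauliAt (aux (b i)) (1, 0)))
        = (pauliAt i p, 1))
    (i : Fin 4) (p : Pauli) (f : ZMod 2) :
    ∃ A, C.Noise A ∧ N.syndrome A = 0 ∧ N.effect A = (pauliAt i p, f) := by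
  have h01 : ∀ f : ZMod 2, f = 0 ∨ f = 1 := by decide
  rcases h01 f with rfl | rfl
  · exact ⟨_, .qubitFlip _ le_rfl _ (hl i) p, h0 i p⟩
  -- The `X` on the auxiliary output of the CNOT flips the report; together with `p` on the control
  -- it is one atomic fault.
  · refine ⟨_, .gateFault _ _ (hτ i) _ fun w hw => ?_, h1 i p⟩
    rw [Gate.outputs, Finset.mem_insert, Finset.mem_singleton, not_or] at hw
    rw [Pi.add_apply, pauliAt, pauliAt, if_neg hw.1, if_neg hw.2, add_zero]

end Analysis

/-! ### Noise of the specification and of the three circuits -/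

theorem zzzzMeasurement_frame (F : Fault (Fin 4 ⊕ Fin 0)) :
    frame zzzzMeasurement.steps 0 F = F 0 + F 1 := by
  change (0 + F 0) + F 1 = _
  rw [zero_add]

theorem zzzzMeasurement_movable (F : Fault (Fin 4 ⊕ Fin 0)) : zzzzMeasurement.Movable F :=
  ⟨⟨trivial, trivial⟩, fun j => j.elim0⟩

theorem zzzzMeasurement_effect (F : Fault (Fin 4 ⊕ Fin 0)) :
    (normalFormZZZZ.effect F).1 = fun i => (F 0 + F 1) (dat i) := by
  rw [← zzzzMeasurement_frame]
  exact add_zero _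

theorem zzzzMeasurement_step {t : ℕ} {s : Step (Fin 4 ⊕ Fin 0) 1}
    (h : zzzzMeasurement.steps[t]? = some s) :
    t = 0 ∧ s = ⟨.measPauliZ (Finset.univ.image dat) 0, .faultTolerant⟩ := by
  cases t with
  | zero => exact ⟨rfl, (Option.some.inj h).symm⟩
  | succ t => cases h

/-- The Paulis `f` before and after a flipped measurement cancel on the data, since the measurement
passes `f` on unchanged. -/
theorem zzzzMeasurement_frame_mem {F : Fault (Fin 4 ⊕ Fin 0)} (hF : zzzzMeasurement.Noise F) :
    ∃ q p, F 0 + F 1 = pauliAt q p := by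
  cases hF with
  | qubitFlip t ht q hq p =>
    refine ⟨q, p, funext fun w => ?_⟩
    have : t = 0 ∨ t = 1 := by
      have : t ≤ 1 := ht
      omega
    rcases this with rfl | rfl <;> simp [faultAt]
  | gateFault t g hg p hp => cases (zzzzMeasurement_step hg).2
  | measFlip t s k hg f hf hanti p hp => cases (zzzzMeasurement_step hg).2
  | measFlipFT t s k hg f hf hanti q hq p =>
    obtain ⟨rfl, -⟩ := zzzzMeasurement_step hg
    refine ⟨q, p, funext fun w => ?_⟩
    simp only [Pi.add_apply, faultAt, zero_add, if_true, zero_ne_one, one_ne_zero, if_false,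
      add_zero]
    rw [← add_assoc, CharTwo.add_self_eq_zero, zero_add]

theorem noiseAnalysis_zzzz : NoiseAnalysis normalFormZZZZ stabZ fun e => WeightOneZ e.1 := by
  refine noiseAnalysis_of_soundZ ⟨fun A hA => ⟨zzzzMeasurement_movable A, fun _ => ?_,
    fun h => absurd rfl h⟩, zzzzMeasurement_movable 0⟩ fun i p f => ?_
  · obtain ⟨q, p, h⟩ := zzzzMeasurement_frame_mem hA
    rw [zzzzMeasurement_effect, h]
    cases q with
    | inl i => exact ⟨0, i, fun j hj => if_neg fun e => hj (Sum.inl_injective e)⟩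
    | inr j => exact j.elim0
  · have h01 : ∀ f : ZMod 2, f = 0 ∨ f = 1 := by decide
    rcases h01 f with rfl | rfl
    · refine ⟨_, .qubitFlip 1 le_rfl (dat i) (by revert i; decide) p, rfl, ?_⟩
      revert i p
      decide +kernel
    -- A single `X` anticommutes with `ZZZZ` and flips the outcome; the Pauli allowed on one output
    -- supplies `p`.
    · refine ⟨_, .measFlipFT 0 _ 0 rfl (pauliAt (dat i) (1, 0))
        (fun w hw => if_neg fun e => hw (by simp [e])) (by revert i; decide +kernel) (dat i)
        (by simp) p, rfl, ?_⟩
      revert i p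
      decide +kernel

theorem noiseAnalysis_shor : NoiseAnalysis normalFormShor stabZ fun e => WeightOneZ e.1 :=
  noiseAnalysis_of_soundZ
    (NormalForm.sound_of_soundAt (by simp [shorCircuit, Step.Simple, Gate.Elementary])
      (by decide +kernel) (by decide +kernel) (by decide +kernel))
    (exists_noise_effect ![1, 2, 3, 4] ![0, 1, 2, 3] (fun i => by fin_cases i <;> rfl)
      (by decide +kernel) (by decide +kernel) (by decide +kernel))

theorem noiseAnalysis_optimised : NoiseAnalysis normalFormOptimised stabZ fun e => WeightOneZ e.1 :=
  noiseAnalysis_of_soundZ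
    (NormalForm.sound_of_soundAt (by simp [optimisedCircuit, Step.Simple, Gate.Elementary])
      (by decide +kernel) (by decide +kernel) (by decide +kernel))
    (exists_noise_effect ![2, 3, 5, 6] ![0, 1, 0, 1] (fun i => by fin_cases i <;> rfl)
      (by decide +kernel) (by decide +kernel) (by decide +kernel))

/-- A correlated CNOT error inside the first `XX` measurement can flip its outcome and also leave a
`Z` that flips the second. Both outcomes are then wrong alike, and the error acts like a `Z` before
both measurements, as with the ideal cat-like map. -/
theorem noiseAnalysis_complete : NoiseAnalysis normalFormComplete stabZ fun e => WeightOneZ e.1 :=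
  noiseAnalysis_of_soundZ
    (NormalForm.sound_of_soundAt
      (by simp [completeCircuit, Step.Simple, Gate.Elementary, xxMeasurement])
      (by decide +kernel) (by decide +kernel) (by decide +kernel))
    (exists_noise_effect ![2, 3, 14, 15] ![0, 1, 0, 1] (fun i => by fin_cases i <;> rfl)
      (by decide +kernel) (by decide +kernel) (by decide +kernel))

/-! ### Noise analysis of the cat-like maps -/

/-- The two tensor factors can be placed on either side of the map. If the eigenvalue must flip and
no factor contains `Z`, then up to `XX` the string is trivial or an `X` on one qubit, and an extra
`Z` on that qubit before and after the map does it. Pairs of atoms of nonzero syndrome thus need no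
separate study. -/
theorem weightOneX_decomposition :
    ∀ e, ∃ e', WeightOneX e' ∧ WeightOneX (e + e') := by decide +kernel

theorem noiseAnalysis_of_soundX {a m r : ℕ} {C : Circuit 2 a m r}
    {base : (Fin r → ZMod 2) → ZMod 2} {N : NormalForm C xProj base}
    (h : (∀ A, C.Noise A → N.Sound WeightOneX (fun _ => True) A) ∧ C.Movable 0)
    (hl : ∀ i, dat i ∈ C.live C.steps.length)
    (h0 : ∀ i p, N.syndrome (faultAt 0 (pauliAt (dat i) p)) = 0 ∧
      N.effect (faultAt 0 (pauliAt (dat i) p)) = (pauliAt i p, p.2))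
    (h1 : ∀ i p, N.syndrome (faultAt C.steps.length (pauliAt (dat i) p)) = 0 ∧
      N.effect (faultAt C.steps.length (pauliAt (dat i) p)) = (pauliAt i p, 0)) :
    NoiseAnalysis N stabX WeightOneX where
  movable_zero := h.2
  movable A hA := (h.1 A hA).1
  effect_mem A hA := (h.1 A hA).2.1
  effect_pair A A' _ _ _ _ := by
    obtain ⟨e, h1, h2⟩ := weightOneX_decomposition (N.effect A + N.effect A')
    refine ⟨_, e, h2, h1, ?_⟩
    rw [add_assoc, show e + e = 0 from
      Prod.ext (funext fun _ => CharTwo.add_self_eq_zero _) (CharTwo.add_self_eq_zero _), add_zero]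
  realised := by
    rintro ⟨P, f⟩ ⟨i, p, c, ⟨hP0, hP1⟩, hf⟩
    have hP : pauliAt i p = P + c • stabX := by
      have hc : ∀ x y : Pauli, ∀ c : ZMod 2, y = x + (c, 0) → x = y + c • (1, 0) := by decide
      funext j
      fin_cases j
      · exact hc _ _ _ hP0
      · exact hc _ _ _ hP1
    -- A Pauli at the end leaves the eigenvalue alone; one at time `0` flips it by its `Z`
    -- component.
    rcases hf with hf | hf
    · exact ⟨_, .qubitFlip _ le_rfl _ (hl i) p, (h1 i p).1, c,
        (h1 i p).2.trans (Prod.ext hP (by simpa using hf.symm))⟩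
    · exact ⟨_, .qubitFlip 0 (Nat.zero_le _) (dat i)
          (Finset.mem_image_of_mem _ (Finset.mem_univ i)) p, (h0 i p).1, c,
        (h0 i p).2.trans (Prod.ext hP (by simpa using hf.symm))⟩

theorem noiseAnalysis_catLike : NoiseAnalysis normalFormCatLike stabX WeightOneX :=
  noiseAnalysis_of_soundX
    (NormalForm.sound_of_soundAt (by simp [catLikeCircuit, Step.Simple])
      (by decide +kernel) (by decide +kernel) (by decide +kernel))
    (by decide +kernel) (by decide +kernel) (by decide +kernel)

theorem noiseAnalysis_implementation : NoiseAnalysis normalFormImplementation stabX WeightOneX :=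
  noiseAnalysis_of_soundX
    (NormalForm.sound_of_soundAt
      (by simp [catLikeImplementation, Step.Simple, Gate.Elementary, xxMeasurement])
      (by decide +kernel) (by decide +kernel) (by decide +kernel))
    (by decide +kernel) (by decide +kernel) (by decide +kernel)

/-! ### The implementable circuit -/

instance {W : Type} [DecidableEq W] {m : ℕ} (live : Finset W) :
    ∀ g : Gate W m, Decidable (g.Legal live)
  | .prepZ q => inferInstanceAs (Decidable (q ∉ live))
  | .prepX q => inferInstanceAs (Decidable (q ∉ live))
  | .cnot c t => inferInstanceAs (Decidable (c ∈ live ∧ t ∈ live ∧ c ≠ t))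
  | .measZ q _ => inferInstanceAs (Decidable (q ∈ live))
  | .measX q _ => inferInstanceAs (Decidable (q ∈ live))
  | .corrZ q _ => inferInstanceAs (Decidable (q ∈ live))
  | .measPauliZ s _ => inferInstanceAs (Decidable (s ⊆ live))
  | .catState q => inferInstanceAs (Decidable (Function.Injective q ∧ ∀ i, q i ∉ live))
  | .catLike q => inferInstanceAs (Decidable (Function.Injective q ∧ ∀ i, q i ∈ live))

theorem completeCircuit_implementable : completeCircuit.Implementable := by
  refine ⟨⟨fun t s h => ?_, by decide +kernel, by decide +kernel⟩, ?_, fun t q k l h => ?_⟩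
  · have key : ∀ x ∈ completeCircuit.steps.zipIdx, x.1.gate.Legal (completeCircuit.live x.2) := by
      decide +kernel
    exact key (s, t) (List.mk_mem_zipIdx_iff_getElem?.2 h)
  · simp [completeCircuit, xxMeasurement, Gate.Elementary]
  · have ht : t < 18 := (List.getElem?_eq_some_iff.1 h).1
    -- Only operations 8 and 13 are corrections; their outcomes come from operations 7 and 12.
    interval_cases t <;> cases h
    · exact ⟨7, by norm_num, _, rfl, rfl⟩
    · exact ⟨12, by norm_num, _, rfl, rfl⟩

end Circuit

end FaultEq

end

open FaultEq FaultEq.Circuit in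
theorem mainTheorem10 :
    -- the optimised circuit is fault-equivalent to the Shor-style circuit and to the specification
    FaultEq.shorCircuit.FaultEquivalent FaultEq.optimisedCircuit ∧
    FaultEq.FaultTolerantZZZZ FaultEq.optimisedCircuit ∧
    -- with half the auxiliary qubits and measurements
    (FaultEq.shorCircuit.auxCount = 4 ∧ FaultEq.optimisedCircuit.auxCount = 2) ∧
    (FaultEq.shorCircuit.measCount = 4 ∧ FaultEq.optimisedCircuit.measCount = 2) ∧
    -- the implementation of the cat-like map
    (FaultEq.catLikeCircuit.FaultEquivalent FaultEq.catLikeImplementation ∧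
      FaultEq.catLikeImplementation.Total) ∧
    -- the complete circuit is implementable, uses three auxiliary qubits, needs no post-selection,
    -- and fault-tolerantly performs the syndrome measurement
    (FaultEq.completeCircuit.Implementable ∧
      FaultEq.completeCircuit.auxCount = 3 ∧
      FaultEq.completeCircuit.Total ∧
      FaultEq.FaultTolerantZZZZ FaultEq.completeCircuit) :=
  ⟨noiseAnalysis_shor.faultEquivalent noiseAnalysis_optimised stabZ_mul_zProj,
    noiseAnalysis_zzzz.faultEquivalent noiseAnalysis_optimised stabZ_mul_zProj,
    ⟨by decide +kernel, by decide +kernel⟩,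
    ⟨by decide +kernel, by decide +kernel⟩,
    ⟨noiseAnalysis_catLike.faultEquivalent noiseAnalysis_implementation stabX_mul_xProj,
      normalFormImplementation.total noiseAnalysis_implementation.movable_zero⟩,
    completeCircuit_implementable,
    by decide +kernel,
    normalFormComplete.total noiseAnalysis_complete.movable_zero,
    noiseAnalysis_zzzz.faultEquivalent noiseAnalysis_complete stabZ_mul_zProj⟩
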